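/- **Setting.** Let $\mathbb{R}^3_H=\{\mathbf t\in\mathbb{R}^3: t_1+t_2+t_3=0\}$, $\mathbb{H}^\dagger=\mathbb{Z}^3\cap\mathbb{R}^3_H$, and $\mathbb{H}=\{\mathbf j\in\mathbb{H}^\dagger: j_1\equiv j_2\equiv j_3 \pmod 3\}$. Let $\mathbf t\sigma_1=-(t_1,t_3,t_2)$, $\mathbf t\sigma_2=-(t_2,t_1,t_3)$, $\mathbf t\sigma_3=-(t_3,t_2,t_1)$, $\mathcal A_2=\{1,\sigma_1,\sigma_2,\sigma_3,\sigma_1\sigma_2,\sigma_2\sigma_1\}$ (acting from the right), $G_2=\{\pm\sigma:\sigma\in\mathcal A_2\}$, and write $\mathbf kG_2$ for the orbit of $\mathbf k$. Let $\triangle=\{\mathbf t\in\mathbb{R}^3_H: 0\le t_2\le t_1\le -t_3\le 1\}$, a $30^\circ$–$60^\circ$–$90^\circ$ triangle with area $|\triangle|$. For $\mathbf k\in\mathbb{H}^\dagger$ let $\phi_{\mathbf k}(\mathbf t)=e^{\frac{2\pi i}{3}\mathbf k\cdot\mathbf t}$. Define $$\mathcal P^{\pm}f(\mathbf t)=\tfrac16\big[f(\mathbf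 t)+f(\mathbf t\sigma_1\sigma_2)+f(\mathbf t\sigma_2\sigma_1)\pm f(\mathbf t\sigma_1)\pm f(\mathbf t\sigma_2)\pm f(\mathbf t\sigma_3)\big],$$ $$\mathcal P_*^{\pm}f(\mathbf t)=\tfrac16\big[f(\mathbf t)+f(\mathbf t\sigma_1\sigma_2)+f(\mathbf t\sigma_2\sigma_1)\pm f(-\mathbf t\sigma_1)\pm f(-\mathbf t\sigma_2)\pm f(-\mathbf t\sigma_3)\big],$$ $$\mathsf{CC}_{\mathbf k}=\mathcal P_*^+\mathcal P^+\phi_{\mathbf k},\quad \mathsf{SC}_{\mathbf k}=\tfrac1i\mathcal P_*^-\mathcal P^+\phi_{\mathbf k},\quad \mathsf{CS}_{\mathbf k}=\tfrac1i\mathcal P_*^+\mathcal P^-\phi_{\mathbf k},\quad \mathsf{SS}_{\mathbf k}=-\mathcal P_*^-\mathcal P^-\phi_{\mathbf k}.$$ For an integer $n$ define the subsets of $\mathbb{H}^\dagger$ $$\Gamma_n^{cc}=\{0\le k_2\le k_1\le k_3+n\},\qquad \Gamma_n^{sc}=\{0\le k_2<k_1<k_3+n\},$$ $$\Gamma_n^{cs}=\{0<k_2\le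 k_1\le k_3+n\},\qquad \Gamma_n^{ss}=\{0<k_2<k_1<k_3+n\},$$ and $\mathcal H_n^{cc}=\operatorname{span}_{\mathbb{C}}\{\mathsf{CC}_{\mathbf k}:\mathbf k\in\Gamma_n^{cc}\}$. The nodes are indexed by $\Upsilon_n=\{\mathbf j\in\mathbb{H}:0\le j_2\le j_1\le -j_3\le n\}$, with interior $\Upsilon_n^\circ=\{\mathbf j\in\mathbb{H}:0<j_2<j_1<-j_3<n\}$. For $\mathbf j\in\mathbb{H}$ with $-n\le j_1,j_2,j_3\le n$ let $c^{(n)}_{\mathbf j}=1$ if $-n<j_1,j_2,j_3<n$, let $c^{(n)}_{\mathbf j}=\frac13$ if $\mathbf j$ is one of the six vertices $(n,0,-n)\sigma$, $\sigma\in G_2$, and let $c^{(n)}_{\mathbf j}=\frac12$ otherwise; put $\omega^{(n)}_{\mathbf j}=c^{(n)}_{\mathbf j}\,|\mathbf jG_2|$. Finally let $\widehat{\mathbf k}=(k_3-k_2,\,k_1-k_3,\,k_2-k_1)$, and let $\delta_{\mathbf j,\mathbf k}$ be $1$ if $\mathbf j=\mathbf k$ and $0$ otherwise. **Theorem.** Let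 $n\ge 1$ be an integer. For all $f\in\mathcal H^{cc}_{2n-1}$, $$\frac1{|\triangle|}\int_\triangle f(\mathbf t)\,d\mathbf t=\frac1{n^2}\sum_{\mathbf j\in\Upsilon_n}\omega^{(n)}_{\mathbf j}\,f\Big(\frac{\mathbf j}{n}\Big).$$ For $\mathbf j\in\Upsilon_n$ the weights are: $\omega^{(n)}_{\mathbf j}=12$ if $\mathbf j\in\Upsilon_n^\circ$; $1$ if $\mathbf j=\mathbf 0$; $2$ if $\mathbf j=(n,0,-n)$; $3$ if $\mathbf j=(\frac n2,\frac n2,-n)$; and $6$ otherwise. Moreover, with $\langle f,g\rangle_{\triangle,n}=\frac1{n^2}\sum_{\mathbf j\in\Upsilon_n}\omega^{(n)}_{\mathbf j}f(\frac{\mathbf j}n)\overline{g(\frac{\mathbf j}n)}$, $$\langle \mathsf{CC}_{\mathbf j},\mathsf{CC}_{\mathbf k}\rangle_{\triangle,n}=\frac{\delta_{\mathbf j,\mathbf k}}{c^{(n)}_{\widehat{\mathbf k}}|\mathbf kG_2|}=\frac{\delta_{\mathbf j,\mathbf k}}{\omega^{(n)}_{\widehat{\mathbf k}}}\qquad(\mathbf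 j,\mathbf k\in\Gamma_n^{cc}),$$ and the same two equalities hold for $\mathsf{SC}$ with $\mathbf j,\mathbf k\in\Gamma_n^{sc}$, for $\mathsf{CS}$ with $\mathbf j,\mathbf k\in\Gamma_n^{cs}$, and for $\mathsf{SS}$ with $\mathbf j,\mathbf k\in\Gamma_n^{ss}$; in the last case the common value is $\delta_{\mathbf j,\mathbf k}/12$. -/

import Mathlib

noncomputable section

namespace G2Triangle

open MeasureTheory

/-- Homogeneous coordinates over a commutative ring `R`: triples with zero sum.
`Homog ℝ` is the plane of points `t` with `t₁ + t₂ + t₃ = 0`, and `Homog ℤ` is the lattice of integer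
triples in it. The coordinates `t₁, t₂, t₃` are `t.1 0, t.1 1, t.1 2`. -/
def Homog (R : Type) [CommRing R] : Submodule R (Fin 3 → R) where
  carrier := {t | t 0 + t 1 + t 2 = 0}
  zero_mem' := by simp
  add_mem' := by
    intro a b ha hb
    simp only [Set.mem_ofPred_eq, Pi.add_apply] at *
    linear_combination ha + hb
  smul_mem' := by
    intro c a ha
    simp only [Set.mem_ofPred_eq, Pi.smul_apply, smul_eq_mul] at *
    linear_combination c * ha

/-- The point `(a, b, c)` in homogeneous coordinates. -/
def pt {R : Type} [CommRing R] (a b c : R) (h : a + b + c = 0) : Homog R :=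
  ⟨![a, b, c], by simpa [Homog] using h⟩

theorem sum_zero {R : Type} [CommRing R] (t : Homog R) : t.1 0 + t.1 1 + t.1 2 = 0 := t.2

/-! ### The groups acting on homogeneous coordinates

The groups act on the right: `t σ₁ σ₂` is `σ₂ (σ₁ t)`. -/

section Groups

variable {R : Type} [CommRing R]

/-- The reflection `t ↦ -(t₁, t₃, t₂)`. -/
def σ₁ (t : Homog R) : Homog R :=
  pt (-t.1 0) (-t.1 2) (-t.1 1) (by linear_combination -sum_zero t)

/-- The reflection `t ↦ -(t₂, t₁, t₃)`. -/
def σ₂ (t : Homog R) : Homog R :=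
  pt (-t.1 1) (-t.1 0) (-t.1 2) (by linear_combination -sum_zero t)

/-- The reflection `t ↦ -(t₃, t₂, t₁)`. -/
def σ₃ (t : Homog R) : Homog R :=
  pt (-t.1 2) (-t.1 1) (-t.1 0) (by linear_combination -sum_zero t)

/-- `t ↦ t σ₁ σ₂`. -/
def σ₁σ₂ (t : Homog R) : Homog R := σ₂ (σ₁ t)

/-- `t ↦ t σ₂ σ₁`. -/
def σ₂σ₁ (t : Homog R) : Homog R := σ₁ (σ₂ t)

variable (R) in
/-- The elements `1, σ₁, σ₂, σ₃, σ₁σ₂, σ₂σ₁` of the reflection group `A₂`. -/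
def groupA2 : Set (Homog R → Homog R) := {id, σ₁, σ₂, σ₃, σ₁σ₂, σ₂σ₁}

variable (R) in
/-- The elements `±σ`, `σ ∈ A₂`, of the group `G₂`. -/
def groupG2 : Set (Homog R → Homog R) := {τ | ∃ σ ∈ groupA2 R, τ = σ ∨ τ = -σ}

/-- The orbit `k G₂`. -/
def orbit (k : Homog R) : Set (Homog R) := {l | ∃ τ ∈ groupG2 R, l = τ k}

/-- `k̂ = (k₃ - k₂, k₁ - k₃, k₂ - k₁)`. -/
def hat (k : Homog R) : Homog R :=
  pt (k.1 2 - k.1 1) (k.1 0 - k.1 2) (k.1 1 - k.1 0) (by ring)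

end Groups

/-! ### Generalized trigonometric functions -/

/-- `φ_k(t) = exp((2πi/3) k · t)`. -/
def φ (k : Homog ℤ) (t : Homog ℝ) : ℂ :=
  Complex.exp (2 * Real.pi * Complex.I / 3 *
    ((k.1 0 * t.1 0 + k.1 1 * t.1 1 + k.1 2 * t.1 2 : ℝ) : ℂ))

/-- The operators `P⁺` (for `ε = 1`) and `P⁻` (for `ε = -1`). -/
def opP (ε : ℂ) (f : Homog ℝ → ℂ) (t : Homog ℝ) : ℂ :=
  1 / 6 * (f t + f (σ₁σ₂ t) + f (σ₂σ₁ t) + ε * f (σ₁ t) + ε * f (σ₂ t) + ε * f (σ₃ t))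

/-- The operators `P⁺_*` (for `ε = 1`) and `P⁻_*` (for `ε = -1`). -/
def opPstar (ε : ℂ) (f : Homog ℝ → ℂ) (t : Homog ℝ) : ℂ :=
  1 / 6 * (f t + f (σ₁σ₂ t) + f (σ₂σ₁ t) +
    ε * f (-σ₁ t) + ε * f (-σ₂ t) + ε * f (-σ₃ t))

def CC (k : Homog ℤ) : Homog ℝ → ℂ := opPstar 1 (opP 1 (φ k))

def SC (k : Homog ℤ) : Homog ℝ → ℂ := fun t => 1 / Complex.I * opPstar (-1) (opP 1 (φ k)) t

def CS (k : Homog ℤ) : Homog ℝ → ℂ := fun t => 1 / Complex.I * opPstar 1 (opP (-1) (φ k)) t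

def SS (k : Homog ℤ) : Homog ℝ → ℂ := fun t => -opPstar (-1) (opP (-1) (φ k)) t

/-! ### Index sets -/

/-- `Γ_n = Γ_n^cc`. -/
def Γcc (n : ℤ) : Set (Homog ℤ) := {k | 0 ≤ k.1 1 ∧ k.1 1 ≤ k.1 0 ∧ k.1 0 ≤ k.1 2 + n}

def Γsc (n : ℤ) : Set (Homog ℤ) := {k | 0 ≤ k.1 1 ∧ k.1 1 < k.1 0 ∧ k.1 0 < k.1 2 + n}

def Γcs (n : ℤ) : Set (Homog ℤ) := {k | 0 < k.1 1 ∧ k.1 1 ≤ k.1 0 ∧ k.1 0 ≤ k.1 2 + n}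

def Γss (n : ℤ) : Set (Homog ℤ) := {k | 0 < k.1 1 ∧ k.1 1 < k.1 0 ∧ k.1 0 < k.1 2 + n}

/-- The space spanned by the functions `CC_k`, `k ∈ Γ_n`. -/
def Hcc (n : ℤ) : Submodule ℂ (Homog ℝ → ℂ) := Submodule.span ℂ (CC '' Γcc n)

/-- The lattice `ℍ` of integer triples with zero sum and mutually congruent entries modulo 3. -/
def latticeH : Set (Homog ℤ) := {j | j.1 0 ≡ j.1 1 [ZMOD 3] ∧ j.1 1 ≡ j.1 2 [ZMOD 3]}

/-- The index set `Υ_n` of the nodes. -/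
def Υ (n : ℤ) : Set (Homog ℤ) :=
  {j | j ∈ latticeH ∧ 0 ≤ j.1 1 ∧ j.1 1 ≤ j.1 0 ∧ j.1 0 ≤ -j.1 2 ∧ -j.1 2 ≤ n}

/-- The interior `Υ_n°`: the indices of the nodes in the interior of the triangle. -/
def Υint (n : ℤ) : Set (Homog ℤ) :=
  {j | j ∈ latticeH ∧ 0 < j.1 1 ∧ j.1 1 < j.1 0 ∧ j.1 0 < -j.1 2 ∧ -j.1 2 < n}

theorem Υ_finite (n : ℤ) : (Υ n).Finite := by
  refine Set.Finite.of_finite_image (f := fun j : Homog ℤ => j.1) ?_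
    (Subtype.val_injective.injOn)
  refine (Set.finite_Icc (fun _ : Fin 3 => -|n|) (fun _ => |n|)).subset ?_
  rintro _ ⟨j, ⟨-, h1, h2, h3, h4⟩, rfl⟩
  have h5 := le_abs_self n
  refine Set.mem_Icc.2 ⟨fun i => ?_, fun i => ?_⟩ <;> fin_cases i <;> simp <;> omega

/-! ### Weights and discrete inner product -/

open Classical in
/-- The weights of the hexagon rule, for `j ∈ ℍ` in the closed hexagon `-n ≤ j₁, j₂, j₃ ≤ n`:
`1` in the interior, `1/3` at the six vertices, `1/2` on the rest of the boundary. -/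
def hexWeight (n : ℤ) (j : Homog ℤ) : ℝ :=
  if ∀ i, -n < j.1 i ∧ j.1 i < n then 1
  else if j ∈ orbit (pt n 0 (-n) (by ring)) then 1 / 3
  else 1 / 2

/-- The weights `ω_j^{(n)} = c_j^{(n)} |j G₂|`. -/
def ω (n : ℤ) (j : Homog ℤ) : ℝ := hexWeight n j * (orbit j).ncard

/-- The point `j / n`. -/
def node (n : ℤ) (j : Homog ℤ) : Homog ℝ :=
  pt ((j.1 0 : ℝ) / n) ((j.1 1 : ℝ) / n) ((j.1 2 : ℝ) / n) (by
    have h : ((j.1 0 : ℝ) + j.1 1 + j.1 2) = 0 := by exact_mod_cast sum_zero j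
    rw [← add_div, ← add_div, h, zero_div])

/-- The cubature sum `n⁻² ∑_{j ∈ Υ_n} ω_j^{(n)} f(j/n)`. -/
def cubature (n : ℤ) (f : Homog ℝ → ℂ) : ℂ :=
  1 / (n : ℂ) ^ 2 * ∑ j ∈ (Υ_finite n).toFinset, (ω n j : ℂ) * f (node n j)

/-- The discrete inner product `⟨f, g⟩_{△,n}`. -/
def discreteInner (n : ℤ) (f g : Homog ℝ → ℂ) : ℂ :=
  cubature n (fun t => f t * starRingEnd ℂ (g t))

/-! ### The triangle and its normalized integral -/

/-- The triangle `△ = {t : 0 ≤ t₂ ≤ t₁ ≤ -t₃ ≤ 1}` with angles 30°, 60°, 90°. -/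
def triangle : Set (Homog ℝ) :=
  {t | 0 ≤ t.1 1 ∧ t.1 1 ≤ t.1 0 ∧ t.1 0 ≤ -t.1 2 ∧ -t.1 2 ≤ 1}

/-- The area measure `dt₁ dt₂` on the plane `t₁ + t₂ + t₃ = 0`. (Any other Lebesgue measure on this
plane is a constant multiple of it, and gives the same normalized integrals.) -/
def area : Measure (Homog ℝ) :=
  (volume : Measure (ℝ × ℝ)).map (fun p => pt p.1 p.2 (-p.1 - p.2) (by ring))

/-- The normalized integral `|△|⁻¹ ∫_△ f(t) dt`. -/
def triangleMean (f : Homog ℝ → ℂ) : ℂ :=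
  1 / (area.real triangle : ℂ) * ∫ t in triangle, f t ∂area

end G2Triangle

end

open G2Triangle

noncomputable section

namespace G2Triangle

open MeasureTheory Equiv

/-! After the substitution `t = hat v` the factor 3 in the exponent of `φ` cancels: `φ k (hat v)` is
`exp (2πi · symp k v)`, where `symp` is the determinant form on the plane. All four families then
become averages `trigSum` of characters over the group of order 12 of signed permutations, weighted
by one of its characters with values `±1`: the trivial one for `CC`, `scalarSign * permSign` for
`SC`, `scalarSign` for `CS` and `permSign` for `SS`.

The nodes correspond to `v = p / n` with `p` an integer point, so on the nodes everything depends
only on `p` modulo `n`, a point of `Homog (ZMod n)`, which has `n²` elements. The set `Γcc n` meets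
each orbit of signed permutations on this finite group exactly once (`castH_smul_eq_imp_eq`,
`exists_mem_Γcc`), and the weight `ω n (hat p)` is the size of the orbit of `p` modulo `n`
(`ω_hat_eq_ncard_orbit`). Hence the cubature sum of a function with invariant values is its plain
average over `Homog (ZMod n)` (`cubature_eq`).

Discrete orthogonality is now orthogonality of characters of a finite abelian group together with
the orbit-stabilizer theorem. The norms do not vanish because the sign character is trivial on the
stabilizers modulo `n` of the indices concerned; this is what the strict inequalities in the index
sets ensure.

For exactness, the mean of `CC k` over the triangle is an integral over a period square, which
twelve congruent images of one triangle fill (`setIntegral_unitSquare`). It is 1 if `k = 0` and 0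
otherwise, whereas the cubature sum is 1 if `k` vanishes modulo `n` and 0 otherwise. In `Γcc (2n -
1)` the two conditions agree. -/

/-! ### The group of order 12 and its action on the plane -/

/-- The signed permutations of three coordinates. -/
abbrev SignedPerm := Perm (Fin 3) × ℤˣ

theorem perm_univ : (Finset.univ : Finset (Perm (Fin 3))) =
    {1, swap 0 1, swap 0 2, swap 1 2, swap 0 1 * swap 1 2, swap 1 2 * swap 0 1} := by
  decide

theorem perm_sum {M : Type*} [AddCommMonoid M] (f : Perm (Fin 3) → M) :
    ∑ π, f π = f 1 + (f (swap 0 1) + (f (swap 0 2) + (f (swap 1 2) +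
      (f (swap 0 1 * swap 1 2) + f (swap 1 2 * swap 0 1))))) := by
  rw [perm_univ, Finset.sum_insert (by decide), Finset.sum_insert (by decide),
    Finset.sum_insert (by decide), Finset.sum_insert (by decide), Finset.sum_insert (by decide),
    Finset.sum_singleton]

theorem perm_cases {p : Perm (Fin 3) → Prop} (h1 : p 1) (h2 : p (swap 0 1)) (h3 : p (swap 0 2))
    (h4 : p (swap 1 2)) (h5 : p (swap 0 1 * swap 1 2)) (h6 : p (swap 1 2 * swap 0 1))
    (π : Perm (Fin 3)) : p π := by
  have h : π ∈ (Finset.univ : Finset (Perm (Fin 3))) := Finset.mem_univ π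
  rw [perm_univ] at h
  simp only [Finset.mem_insert, Finset.mem_singleton] at h
  rcases h with rfl | rfl | rfl | rfl | rfl | rfl <;> assumption

theorem signedPerm_sum {M : Type*} [AddCommMonoid M] (f : SignedPerm → M) :
    ∑ g, f g = ∑ π, f (π, 1) + ∑ π, f (π, -1) := by
  rw [Fintype.sum_prod_type_right, show (Finset.univ : Finset ℤˣ) = {1, -1} from rfl,
    Finset.sum_pair (by decide)]

theorem card_signedPerm : Fintype.card SignedPerm = 12 := by
  simp [Fintype.card_perm, Nat.factorial]

section Action

variable {R : Type} [CommRing R]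

theorem homog_ext {s t : Homog R} (h0 : s.1 0 = t.1 0) (h1 : s.1 1 = t.1 1) : s = t := by
  have hs := sum_zero s
  have ht := sum_zero t
  ext i
  fin_cases i
  · exact h0
  · exact h1
  · show s.1 2 = t.1 2
    linear_combination hs - ht - h0 - h1

theorem homog_ext_iff {s t : Homog R} : s = t ↔ s.1 0 = t.1 0 ∧ s.1 1 = t.1 1 :=
  ⟨fun h => by simp [h], fun h => homog_ext h.1 h.2⟩

instance : MulAction SignedPerm (Homog R) where
  smul g t := ⟨fun i => ((g.2 : ℤ) : R) * t.1 (g.1⁻¹ i), by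
    have h : ∑ i, t.1 (g.1⁻¹ i) = ∑ i, t.1 i := Equiv.sum_comp g.1⁻¹ t.1
    rw [Fin.sum_univ_three, Fin.sum_univ_three, sum_zero] at h
    show _ + _ + _ = (0 : R)
    rw [← mul_add, ← mul_add, h, mul_zero]⟩
  one_smul t := by
    ext i
    show (((1 : ℤˣ) : ℤ) : R) * t.1 ((1 : Perm (Fin 3))⁻¹ i) = t.1 i
    simp
  mul_smul g h t := by
    ext i
    show (((g.2 * h.2 : ℤˣ) : ℤ) : R) * t.1 ((g.1 * h.1)⁻¹ i) =
      ((g.2 : ℤ) : R) * (((h.2 : ℤ) : R) * t.1 (h.1⁻¹ (g.1⁻¹ i)))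
    simp [mul_assoc]

theorem smul_coord (g : SignedPerm) (t : Homog R) (i : Fin 3) :
    (g • t).1 i = ((g.2 : ℤ) : R) * t.1 (g.1⁻¹ i) := rfl

theorem smul_mk_one (π : Perm (Fin 3)) (t : Homog R) (i : Fin 3) :
    (((π, 1) : SignedPerm) • t).1 i = t.1 (π⁻¹ i) := by
  simp [smul_coord]

theorem smul_mk_neg_one (π : Perm (Fin 3)) (t : Homog R) (i : Fin 3) :
    (((π, -1) : SignedPerm) • t).1 i = -t.1 (π⁻¹ i) := by
  simp [smul_coord]

theorem smul_mk_neg_one_eq (π : Perm (Fin 3)) (t : Homog R) :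
    ((π, -1) : SignedPerm) • t = -(((π, 1) : SignedPerm) • t) := by
  ext i
  simp [smul_mk_one, smul_mk_neg_one]

theorem smul_one_one (t : Homog R) : ((1, 1) : SignedPerm) • t = t := one_smul _ t

theorem smul_swap01 (t : Homog R) : ((swap 0 1, 1) : SignedPerm) • t =
    pt (t.1 1) (t.1 0) (t.1 2) (by linear_combination sum_zero t) := by
  apply homog_ext <;> rw [smul_mk_one] <;> rfl

theorem smul_swap02 (t : Homog R) : ((swap 0 2, 1) : SignedPerm) • t =
    pt (t.1 2) (t.1 1) (t.1 0) (by linear_combination sum_zero t) := by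
  apply homog_ext <;> rw [smul_mk_one] <;> rfl

theorem smul_swap12 (t : Homog R) : ((swap 1 2, 1) : SignedPerm) • t =
    pt (t.1 0) (t.1 2) (t.1 1) (by linear_combination sum_zero t) := by
  apply homog_ext <;> rw [smul_mk_one] <;> rfl

theorem smul_rot (t : Homog R) : ((swap 0 1 * swap 1 2, 1) : SignedPerm) • t =
    pt (t.1 2) (t.1 0) (t.1 1) (by linear_combination sum_zero t) := by
  apply homog_ext <;> rw [smul_mk_one] <;> rfl

theorem smul_rot_inv (t : Homog R) : ((swap 1 2 * swap 0 1, 1) : SignedPerm) • t =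
    pt (t.1 1) (t.1 2) (t.1 0) (by linear_combination sum_zero t) := by
  apply homog_ext <;> rw [smul_mk_one] <;> rfl

@[simp] theorem pt_zero (a b c : R) (h : a + b + c = 0) : (pt a b c h).1 0 = a := rfl
@[simp] theorem pt_one (a b c : R) (h : a + b + c = 0) : (pt a b c h).1 1 = b := rfl
@[simp] theorem pt_two (a b c : R) (h : a + b + c = 0) : (pt a b c h).1 2 = c := rfl

theorem neg_pt (a b c : R) (h : a + b + c = 0) :
    -pt a b c h = pt (-a) (-b) (-c) (by linear_combination -h) := by
  apply homog_ext <;> simp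

theorem signedPerm_cases {p : SignedPerm → Prop} (h1 : ∀ π, p (π, 1)) (h2 : ∀ π, p (π, -1))
    (g : SignedPerm) : p g := by
  obtain ⟨π, ε⟩ := g
  rcases Int.units_eq_one_or ε with rfl | rfl
  exacts [h1 π, h2 π]

theorem pt_self (t : Homog R) : pt (t.1 0) (t.1 1) (t.1 2) t.2 = t := homog_ext rfl rfl

/-- Each `σᵢ` is minus a transposition, so the elements `±σ` are exactly the signed permutations. -/
theorem orbit_eq (k : Homog R) : orbit k = MulAction.orbit SignedPerm k := by
  apply Set.Subset.antisymm
  · rintro _ ⟨τ, ⟨σ, hσ, hτ⟩, rfl⟩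
    have key : ∀ l : Homog R, l ∈ MulAction.orbit SignedPerm k →
        -l ∈ MulAction.orbit SignedPerm k := by
      rintro _ ⟨⟨π, ε⟩, rfl⟩
      refine ⟨(π, -ε), ?_⟩
      ext i
      simp [smul_coord]
    have h : σ k ∈ MulAction.orbit SignedPerm k := by
      simp only [groupA2, Set.mem_insert_iff, Set.mem_singleton_iff] at hσ
      rcases hσ with rfl | rfl | rfl | rfl | rfl | rfl
      · exact MulAction.mem_orbit_self k
      · exact ⟨(swap 1 2, -1), by
          simp only [smul_mk_neg_one_eq, smul_swap12, neg_pt]; rfl⟩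
      · exact ⟨(swap 0 1, -1), by
          simp only [smul_mk_neg_one_eq, smul_swap01, neg_pt]; rfl⟩
      · exact ⟨(swap 0 2, -1), by
          simp only [smul_mk_neg_one_eq, smul_swap02, neg_pt]; rfl⟩
      · exact ⟨(swap 0 1 * swap 1 2, 1), by
          simp only [smul_rot, σ₁σ₂, σ₁, σ₂, pt_zero, pt_one, pt_two, neg_neg]⟩
      · exact ⟨(swap 1 2 * swap 0 1, 1), by
          simp only [smul_rot_inv, σ₂σ₁, σ₁, σ₂, pt_zero, pt_one, pt_two, neg_neg]⟩
    rcases hτ with rfl | rfl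
    · exact h
    · exact key _ h
  · have key : ∀ l : Homog R, l ∈ orbit k → -l ∈ orbit k := by
      rintro _ ⟨τ, ⟨σ, hσ, hτ⟩, rfl⟩
      rcases hτ with rfl | rfl
      · exact ⟨-τ, ⟨τ, hσ, Or.inr rfl⟩, rfl⟩
      · exact ⟨σ, ⟨σ, hσ, Or.inl rfl⟩, by simp⟩
    have mem : ∀ σ ∈ groupA2 R, σ k ∈ orbit k := fun σ hσ => ⟨σ, ⟨σ, hσ, Or.inl rfl⟩, rfl⟩
    have pos : ∀ π : Perm (Fin 3), ((π, 1) : SignedPerm) • k ∈ orbit k := by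
      refine perm_cases ?_ ?_ ?_ ?_ ?_ ?_
      · rw [smul_one_one]; exact mem id (by simp [groupA2])
      · convert key _ (mem σ₂ (by simp [groupA2])) using 1
        rw [smul_swap01, σ₂, neg_pt]; simp only [neg_neg]
      · convert key _ (mem σ₃ (by simp [groupA2])) using 1
        rw [smul_swap02, σ₃, neg_pt]; simp only [neg_neg]
      · convert key _ (mem σ₁ (by simp [groupA2])) using 1
        rw [smul_swap12, σ₁, neg_pt]; simp only [neg_neg]
      · convert mem σ₁σ₂ (by simp [groupA2]) using 1
        simp only [smul_rot, σ₁σ₂, σ₁, σ₂, pt_zero, pt_one, pt_two, neg_neg]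
      · convert mem σ₂σ₁ (by simp [groupA2]) using 1
        simp only [smul_rot_inv, σ₂σ₁, σ₁, σ₂, pt_zero, pt_one, pt_two, neg_neg]
    rintro _ ⟨g, rfl⟩
    refine signedPerm_cases (p := fun g => g • k ∈ orbit k) pos (fun π => ?_) g
    rw [smul_mk_neg_one_eq]
    exact key _ (pos π)

/-! ### The form `symp` and the map `hat` -/

/-- The invariant alternating form `⟨k, v̂⟩ / 3`. -/
def symp (k v : Homog R) : R := k.1 1 * v.1 0 - k.1 0 * v.1 1

/-- The form is a 2×2 determinant, and `g` acts on the plane with determinant `Perm.sign g.1`: the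
scalar `-1` has determinant 1 in dimension two. -/
theorem symp_smul (g : SignedPerm) (k v : Homog R) :
    symp (g • k) (g • v) = ((Perm.sign g.1 : ℤ) : R) * symp k v := by
  have hk : k.1 2 = -k.1 0 - k.1 1 := by linear_combination sum_zero k
  have hv : v.1 2 = -v.1 0 - v.1 1 := by linear_combination sum_zero v
  have s3 : Perm.sign (swap (0 : Fin 3) 1) = -1 := by decide
  have s4 : Perm.sign (swap (0 : Fin 3) 2) = -1 := by decide
  have s5 : Perm.sign (swap (1 : Fin 3) 2) = -1 := by decide
  have pos : ∀ π : Perm (Fin 3), symp (((π, 1) : SignedPerm) • k) (((π, 1) : SignedPerm) • v) =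
      ((Perm.sign π : ℤ) : R) * symp k v := by
    refine perm_cases ?_ ?_ ?_ ?_ ?_ ?_ <;>
    simp only [smul_one_one, smul_swap01, smul_swap02, smul_swap12, smul_rot, smul_rot_inv, symp,
      pt_zero, pt_one, Perm.sign_one, s3, s4, s5, Perm.sign_mul, hk, hv] <;>
    push_cast <;> ring
  refine signedPerm_cases (p := fun g => symp (g • k) (g • v) =
    ((Perm.sign g.1 : ℤ) : R) * symp k v) pos (fun π => ?_) g
  rw [smul_mk_neg_one_eq, smul_mk_neg_one_eq, ← pos]
  simp [symp]

/-- The map `hat` is the cross product with `(1, 1, 1)`, so an odd permutation costs a sign. -/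
theorem hat_smul (g : SignedPerm) (k : Homog R) :
    hat (g • k) = ((g.1, g.2 * Perm.sign g.1) : SignedPerm) • hat k := by
  have s3 : Perm.sign (swap (0 : Fin 3) 1) = -1 := by decide
  have s4 : Perm.sign (swap (0 : Fin 3) 2) = -1 := by decide
  have s5 : Perm.sign (swap (1 : Fin 3) 2) = -1 := by decide
  have pos : ∀ π : Perm (Fin 3), hat (((π, 1) : SignedPerm) • k) =
      ((π, Perm.sign π) : SignedPerm) • hat k := by
    refine perm_cases ?_ ?_ ?_ ?_ ?_ ?_ <;>
    simp only [smul_one_one, smul_swap01, smul_swap02, smul_swap12, smul_rot, smul_rot_inv, hat,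
      pt_zero, pt_one, pt_two, Perm.sign_one, s3, s4, s5, Perm.sign_mul, smul_mk_neg_one_eq,
      mul_neg, mul_one, neg_neg, neg_pt, neg_sub]
  refine signedPerm_cases (p := fun g => hat (g • k) =
    ((g.1, g.2 * Perm.sign g.1) : SignedPerm) • hat k) (fun π => ?_) (fun π => ?_) g
  · rw [pos, one_mul]
  · rw [smul_mk_neg_one_eq]
    have h : hat (-(((π, 1) : SignedPerm) • k)) = -hat (((π, 1) : SignedPerm) • k) := by
      apply homog_ext <;> simp [hat] <;> ring
    rw [h, pos]
    ext i
    simp [smul_coord]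

theorem dot_smul (g : SignedPerm) (k t : Homog R) :
    k.1 0 * (g • t).1 0 + k.1 1 * (g • t).1 1 + k.1 2 * (g • t).1 2 =
      (g⁻¹ • k).1 0 * t.1 0 + (g⁻¹ • k).1 1 * t.1 1 + (g⁻¹ • k).1 2 * t.1 2 := by
  have h1 := Equiv.sum_comp g.1 (fun i => k.1 i * (g • t).1 i)
  rw [Fin.sum_univ_three] at h1
  rw [Fin.sum_univ_three] at h1
  rw [← h1]
  have hε : g.2⁻¹ = g.2 := Int.units_inv_eq_self g.2
  simp only [smul_coord, Prod.fst_inv, Prod.snd_inv, hε, Perm.inv_def,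
    Equiv.symm_apply_apply, Equiv.symm_symm]
  ring

theorem dot_hat (k v : Homog R) :
    k.1 0 * (hat v).1 0 + k.1 1 * (hat v).1 1 + k.1 2 * (hat v).1 2 = 3 * symp k v := by
  have hk : k.1 2 = -k.1 0 - k.1 1 := by linear_combination sum_zero k
  have hv : v.1 2 = -v.1 0 - v.1 1 := by linear_combination sum_zero v
  simp only [hat, symp, pt_zero, pt_one, pt_two, hk, hv]
  ring

end Action

/-! ### Orbit-stabilizer counting and invariance of the weights -/

section Stabilizer

variable {R : Type} [CommRing R] [DecidableEq R]

/-- The number of signed permutations that fix `k`. -/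
def stabCard (k : Homog R) : ℕ := ∑ g : SignedPerm, if g • k = k then 1 else 0

theorem card_stabilizer (k : Homog R) :
    Nat.card (MulAction.stabilizer SignedPerm k) = stabCard k := by
  rw [stabCard, Finset.sum_boole, Nat.cast_id]
  have h : (MulAction.stabilizer SignedPerm k : Set SignedPerm) =
      ((Finset.univ.filter fun g : SignedPerm => g • k = k : Finset SignedPerm) :
        Set SignedPerm) := by
    ext g; simp
  rw [← Set.ncard_coe_finset, ← h]
  rfl

theorem ncard_orbit_mul_stabCard (k : Homog R) : (orbit k).ncard * stabCard k = 12 := by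
  rw [orbit_eq, ← card_stabilizer, ← card_signedPerm, ← Nat.card_eq_fintype_card]
  have h := Nat.card_congr (MulAction.orbitProdStabilizerEquivGroup SignedPerm k)
  rwa [Nat.card_prod, Nat.card_coe_set_eq] at h

end Stabilizer

theorem hat_injective : Function.Injective (hat : Homog ℤ → Homog ℤ) := by
  intro k l h
  rw [homog_ext_iff] at h ⊢
  have hk := sum_zero k
  have hl := sum_zero l
  simp only [hat, pt_zero, pt_one] at h
  omega

theorem mem_orbit_smul {R : Type} [CommRing R] (g : SignedPerm) {k l : Homog R} :
    g • k ∈ orbit l ↔ k ∈ orbit l := by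
  rw [orbit_eq, ← MulAction.orbit_eq_iff, ← MulAction.orbit_eq_iff, MulAction.orbit_smul]

theorem orbit_smul {R : Type} [CommRing R] (g : SignedPerm) (k : Homog R) :
    orbit (g • k) = orbit k := by
  rw [orbit_eq, orbit_eq, MulAction.orbit_smul]

theorem orbit_hat (k : Homog ℤ) : orbit (hat k) = hat '' orbit k := by
  rw [orbit_eq, orbit_eq]
  ext l
  constructor
  · rintro ⟨g, rfl⟩
    refine ⟨((g.1, g.2 * Perm.sign g.1) : SignedPerm) • k, ⟨_, rfl⟩, ?_⟩
    rw [hat_smul]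
    simp only [mul_assoc, Int.units_mul_self, mul_one]
  · rintro ⟨_, ⟨g, rfl⟩, rfl⟩
    exact ⟨((g.1, g.2 * Perm.sign g.1) : SignedPerm), (hat_smul g k).symm⟩

theorem ncard_orbit_hat (k : Homog ℤ) : (orbit (hat k)).ncard = (orbit k).ncard := by
  rw [orbit_hat, Set.ncard_image_of_injective _ hat_injective]

theorem hexWeight_smul (n : ℤ) (g : SignedPerm) (j : Homog ℤ) :
    hexWeight n (g • j) = hexWeight n j := by
  have h : (∀ i, -n < (g • j).1 i ∧ (g • j).1 i < n) ↔ ∀ i, -n < j.1 i ∧ j.1 i < n := by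
    have h1 : ∀ i, (-n < (g • j).1 i ∧ (g • j).1 i < n) ↔
        -n < j.1 (g.1⁻¹ i) ∧ j.1 (g.1⁻¹ i) < n := by
      intro i
      rw [smul_coord]
      rcases Int.units_eq_one_or g.2 with h | h <;> (rw [h]; simp; try omega)
    rw [forall_congr' h1]
    exact ⟨fun h i => by simpa using h (g.1 i), fun h i => h _⟩
  have h2 := mem_orbit_smul g (k := j) (l := pt n 0 (-n) (by ring))
  classical
  simp only [hexWeight, h]
  congr 1
  exact if_congr h2 rfl rfl

theorem ω_smul (n : ℤ) (g : SignedPerm) (j : Homog ℤ) : ω n (g • j) = ω n j := by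
  rw [ω, ω, hexWeight_smul, orbit_smul]

/-! ### Reduction modulo `n` and the fundamental domain `Γcc n` -/

/-- The image of a lattice point over another ring. -/
def castH (R : Type) [CommRing R] (k : Homog ℤ) : Homog R :=
  pt (k.1 0 : R) (k.1 1 : R) (k.1 2 : R) (by
    have h := sum_zero k
    exact_mod_cast congrArg (Int.cast : ℤ → R) h)

section Cast

theorem coord_neg {R : Type} [CommRing R] (k : Homog R) (i : Fin 3) : (-k).1 i = -k.1 i := rfl

variable (R : Type) [CommRing R]

theorem castH_coord (k : Homog ℤ) (i : Fin 3) : (castH R k).1 i = (k.1 i : R) := by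
  fin_cases i <;> rfl

theorem castH_smul (g : SignedPerm) (k : Homog ℤ) : castH R (g • k) = g • castH R k := by
  ext i
  simp [castH_coord, smul_coord]

theorem symp_castH (k v : Homog ℤ) : symp (castH R k) (castH R v) = ((symp k v : ℤ) : R) := by
  simp [symp, castH_coord]

end Cast

theorem dvd_iff_of_lt_two_mul {n a : ℤ} (h1 : -(2 * n) < a) (h2 : a < 2 * n) :
    n ∣ a ↔ a = 0 ∨ a = n ∨ a = -n := by
  constructor
  · rintro ⟨c, rfl⟩
    have hn : 0 < n := by omega
    have hc1 : -2 < c := by nlinarith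
    have hc2 : c < 2 := by nlinarith
    interval_cases c <;> simp
  · rintro (rfl | rfl | rfl) <;> simp

theorem castH_zmod_eq_iff {n : ℕ} (p q : Homog ℤ) :
    castH (ZMod n) p = castH (ZMod n) q ↔
      (n : ℤ) ∣ p.1 0 - q.1 0 ∧ (n : ℤ) ∣ p.1 1 - q.1 1 := by
  rw [homog_ext_iff]
  simp only [castH_coord]
  rw [eq_comm, eq_comm (a := ((p.1 1 : ℤ) : ZMod n)), ZMod.intCast_eq_intCast_iff_dvd_sub,
    ZMod.intCast_eq_intCast_iff_dvd_sub]

theorem castH_zmod_eq_iff_of_lt {n : ℕ} {p q : Homog ℤ}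
    (h : (-(2 * n : ℤ) < p.1 0 - q.1 0 ∧ p.1 0 - q.1 0 < 2 * n) ∧
      (-(2 * n : ℤ) < p.1 1 - q.1 1 ∧ p.1 1 - q.1 1 < 2 * n)) :
    castH (ZMod n) p = castH (ZMod n) q ↔
      (p.1 0 - q.1 0 = 0 ∨ p.1 0 - q.1 0 = n ∨ p.1 0 - q.1 0 = -n) ∧
      (p.1 1 - q.1 1 = 0 ∨ p.1 1 - q.1 1 = n ∨ p.1 1 - q.1 1 = -n) := by
  rw [castH_zmod_eq_iff, dvd_iff_of_lt_two_mul h.1.1 h.1.2, dvd_iff_of_lt_two_mul h.2.1 h.2.2]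

/-- Uniqueness of representatives: `Γcc n` is a closed chamber of the affine reflection group
generated by signed permutations and translations by `n`. -/
theorem castH_smul_eq_imp_eq {n : ℕ} {p q : Homog ℤ} (hp : p ∈ Γcc n) (hq : q ∈ Γcc n)
    (hn : 0 < n) (g : SignedPerm) (h : castH (ZMod n) (g • p) = castH (ZMod n) q) : p = q := by
  have sp := sum_zero p
  have sq := sum_zero q
  obtain ⟨hp1, hp2, hp3⟩ := hp
  obtain ⟨hq1, hq2, hq3⟩ := hq
  rw [homog_ext_iff]
  revert h
  refine signedPerm_cases (p := fun g => castH (ZMod n) (g • p) = castH (ZMod n) q →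
    p.1 0 = q.1 0 ∧ p.1 1 = q.1 1) ?_ ?_ g <;>
  refine perm_cases ?_ ?_ ?_ ?_ ?_ ?_ <;>
  (intro h
   simp only [smul_mk_neg_one_eq, smul_one_one, smul_swap01, smul_swap02, smul_swap12, smul_rot,
     smul_rot_inv, neg_pt] at h
   -- Coordinates of points of `Γcc n` have absolute value at most `2n/3`, so differences are below
   -- `2n` in absolute value and each congruence leaves only the values `0`, `n`, `-n`.
   rw [castH_zmod_eq_iff_of_lt (by
     (try simp only [pt_zero, pt_one, coord_neg]); omega)] at h
   (try simp only [pt_zero, pt_one, coord_neg] at h)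
   omega)

/-- The hypothesis describes a hexagon around the origin, which is the union of the twelve images of
the chamber. -/
theorem exists_smul_mem_Γcc {n : ℕ} {k : Homog ℤ}
    (h : |k.1 0 - k.1 1| ≤ n ∧ |k.1 1 - k.1 2| ≤ n ∧ |k.1 0 - k.1 2| ≤ n) :
    ∃ g : SignedPerm, g • k ∈ Γcc n := by
  simp only [abs_le] at h
  have sk := sum_zero k
  by_contra hc
  have hg : ∀ g : SignedPerm, ¬ (0 ≤ (g • k).1 1 ∧ (g • k).1 1 ≤ (g • k).1 0 ∧
      (g • k).1 0 ≤ (g • k).1 2 + n) := fun g hg => hc ⟨g, hg⟩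
  have a1 := hg (1, 1)
  have a2 := hg (swap 0 1, 1)
  have a3 := hg (swap 0 2, 1)
  have a4 := hg (swap 1 2, 1)
  have a5 := hg (swap 0 1 * swap 1 2, 1)
  have a6 := hg (swap 1 2 * swap 0 1, 1)
  have b1 := hg (1, -1)
  have b2 := hg (swap 0 1, -1)
  have b3 := hg (swap 0 2, -1)
  have b4 := hg (swap 1 2, -1)
  have b5 := hg (swap 0 1 * swap 1 2, -1)
  have b6 := hg (swap 1 2 * swap 0 1, -1)
  simp only [smul_mk_neg_one_eq, smul_one_one, smul_swap01, smul_swap02, smul_swap12, smul_rot,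
     smul_rot_inv, neg_pt, pt_zero, pt_one, pt_two, coord_neg]
     at a1 a2 a3 a4 a5 a6 b1 b2 b3 b4 b5 b6
  clear hg hc
  rcases le_total (k.1 0) (k.1 1) with h1 | h1 <;>
  rcases le_total (k.1 1) (k.1 2) with h2 | h2 <;>
  rcases le_total (k.1 0) (k.1 2) with h3 | h3 <;>
  rcases le_total 0 (k.1 0) with h4 | h4 <;>
  rcases le_total 0 (k.1 1) with h5 | h5 <;>
  rcases le_total 0 (k.1 2) with h6 | h6 <;>
  first | (clear a1 a2 a3 a4 a5 a6; omega) | (clear b1 b2 b3 b4 b5 b6; omega)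

theorem exists_mem_Γcc {n : ℕ} (hn : 0 < n) (x : Homog (ZMod n)) :
    ∃ p ∈ Γcc n, ∃ g : SignedPerm, g • castH (ZMod n) p = x := by
  have : NeZero n := ⟨hn.ne'⟩
  obtain ⟨a, ha0, han, ha⟩ : ∃ a : ℤ, 0 ≤ a ∧ a < n ∧ ((a : ℤ) : ZMod n) = x.1 0 :=
    ⟨(x.1 0).val, by positivity, by exact_mod_cast ZMod.val_lt _, by simp⟩
  obtain ⟨b, hb0, hbn, hb⟩ : ∃ b : ℤ, 0 ≤ b ∧ b < n ∧ ((b : ℤ) : ZMod n) = x.1 1 :=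
    ⟨(x.1 1).val, by positivity, by exact_mod_cast ZMod.val_lt _, by simp⟩
  obtain ⟨k, hk, hx⟩ : ∃ k : Homog ℤ,
      (|k.1 0 - k.1 1| ≤ n ∧ |k.1 1 - k.1 2| ≤ n ∧ |k.1 0 - k.1 2| ≤ n) ∧
        castH (ZMod n) k = x := by
    -- Translates of the hexagon by the lattice `n • Homog ℤ` cover the plane. For residues in `[0,
    -- n)` it is enough to shift each coordinate by `0` or `-n`.
    have key : ∃ c d : ℤ, (c = a ∨ c = a - n) ∧ (d = b ∨ d = b - n) ∧
        |c - d| ≤ n ∧ |d - (-c - d)| ≤ n ∧ |c - (-c - d)| ≤ n := by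
      simp only [abs_le]
      by_contra hc
      push Not at hc
      have h1 := hc a b (Or.inl rfl) (Or.inl rfl)
      have h2 := hc (a - n) b (Or.inr rfl) (Or.inl rfl)
      have h3 := hc a (b - n) (Or.inl rfl) (Or.inr rfl)
      have h4 := hc (a - n) (b - n) (Or.inr rfl) (Or.inr rfl)
      clear hc
      omega
    obtain ⟨c, d, hc, hd, h⟩ := key
    refine ⟨pt c d (-c - d) (by ring), h, homog_ext ?_ ?_⟩
    · rw [castH_coord, ← ha, pt_zero]
      rcases hc with rfl | rfl <;> simp
    · rw [castH_coord, ← hb, pt_one]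
      rcases hd with rfl | rfl <;> simp
  obtain ⟨g, hg⟩ := exists_smul_mem_Γcc hk
  exact ⟨_, hg, g⁻¹, by rw [← castH_smul, inv_smul_smul, hx]⟩

/-! ### Stabilizers and weights on the chamber -/

theorem stabCard_Γcc {n : ℕ} {k : Homog ℤ} (hk : k ∈ Γcc n) :
    stabCard k = if k.1 0 = k.1 1 ∧ k.1 1 = 0 then 12 else
      if k.1 0 = k.1 1 ∨ k.1 1 = 0 then 2 else 1 := by
  have sk := sum_zero k
  obtain ⟨h1, h2, h3⟩ := hk
  rw [stabCard, signedPerm_sum, perm_sum, perm_sum]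
  simp only [smul_mk_neg_one_eq, smul_one_one, smul_swap01, smul_swap02, smul_swap12, smul_rot,
     smul_rot_inv, neg_pt, homog_ext_iff, pt_zero, pt_one, coord_neg]
  by_cases hX : k.1 0 = k.1 1 <;> by_cases hY : k.1 1 = 0
  · have hZ : k.1 2 = 0 := by omega
    simp [hX, hY, hZ]
  all_goals
    repeat (first | rw [if_pos (by first | trivial | omega)] | rw [if_neg (by omega)])
    try rfl

theorem zmod_smul_eq_self_iff {n : ℕ} (hn : 0 < n) {k : Homog ℤ} (hk : k ∈ Γcc n)
    (g : SignedPerm) : g • castH (ZMod n) k = castH (ZMod n) k ↔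
      ((g • k).1 0 - k.1 0 = 0 ∨ (g • k).1 0 - k.1 0 = n ∨ (g • k).1 0 - k.1 0 = -n) ∧
      ((g • k).1 1 - k.1 1 = 0 ∨ (g • k).1 1 - k.1 1 = n ∨ (g • k).1 1 - k.1 1 = -n) := by
  have sk := sum_zero k
  obtain ⟨h1, h2, h3⟩ := hk
  rw [← castH_smul, castH_zmod_eq_iff_of_lt]
  refine signedPerm_cases (p := fun g => (-(2 * n : ℤ) < (g • k).1 0 - k.1 0 ∧
    (g • k).1 0 - k.1 0 < 2 * n) ∧
      (-(2 * n : ℤ) < (g • k).1 1 - k.1 1 ∧ (g • k).1 1 - k.1 1 < 2 * n)) ?_ ?_ g <;>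
  refine perm_cases ?_ ?_ ?_ ?_ ?_ ?_ <;>
  simp only [smul_mk_neg_one_eq, smul_one_one, smul_swap01, smul_swap02, smul_swap12, smul_rot,
     smul_rot_inv, neg_pt, pt_zero, pt_one, coord_neg] <;> omega

/-- The walls `k₁ = k₂`, `k₂ = 0` and `k₁ = k₃ + n` are the mirrors of the chamber; modulo `n` the
third one counts as well. Corner angles 30°, 60° and 90° give stabilizers of order 12, 6 and 4. -/
theorem stabCard_castH_Γcc {n : ℕ} (hn : 0 < n) {k : Homog ℤ} (hk : k ∈ Γcc n) :
    stabCard (castH (ZMod n) k) = if k.1 0 = k.1 1 ∧ k.1 1 = 0 then 12 else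
      if k.1 0 = k.1 1 ∧ k.1 0 = k.1 2 + n then 6 else
      if k.1 1 = 0 ∧ k.1 0 = k.1 2 + n then 4 else
      if k.1 0 = k.1 1 ∨ k.1 1 = 0 ∨ k.1 0 = k.1 2 + n then 2 else 1 := by
  have sk := sum_zero k
  rw [stabCard, signedPerm_sum, perm_sum, perm_sum]
  simp only [zmod_smul_eq_self_iff hn hk]
  obtain ⟨h1, h2, h3⟩ := hk
  simp only [smul_mk_neg_one_eq, smul_one_one, smul_swap01, smul_swap02, smul_swap12, smul_rot,
     smul_rot_inv, neg_pt, pt_zero, pt_one, coord_neg]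
  by_cases hX : k.1 0 = k.1 1 <;> by_cases hY : k.1 1 = 0 <;> by_cases hZ : k.1 0 = k.1 2 + n
  · omega
  · have hk2 : k.1 2 = 0 := by omega
    simp [hX, hY, hk2]
  all_goals
    repeat (first | rw [if_pos (by first | trivial | omega)] | rw [if_neg (by omega)])
    try rfl

theorem hexWeight_hat_Γcc {n : ℕ} (hn : 0 < n) {k : Homog ℤ} (hk : k ∈ Γcc n) :
    hexWeight n (hat k) = if k.1 0 = k.1 2 + n then (if k.1 0 = k.1 1 then 1 / 3 else 1 / 2)
      else 1 := by
  have sk := sum_zero k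
  obtain ⟨h1, h2, h3⟩ := hk
  have hin : (∀ i, -(n : ℤ) < (hat k).1 i ∧ (hat k).1 i < n) ↔ ¬ k.1 0 = k.1 2 + n := by
    rw [Fin.forall_fin_succ, Fin.forall_fin_two]
    simp only [hat]
    show (_ < k.1 2 - k.1 1 ∧ k.1 2 - k.1 1 < _) ∧ (_ < k.1 0 - k.1 2 ∧ k.1 0 - k.1 2 < _) ∧
      (_ < k.1 1 - k.1 0 ∧ k.1 1 - k.1 0 < _) ↔ _
    omega
  rw [hexWeight]
  simp only [hin]
  by_cases hZ : k.1 0 = k.1 2 + n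
  · simp only [hZ, not_true_eq_false, if_true, if_false]
    congr 1
    rw [eq_iff_iff, ← hZ]
    constructor
    · rw [orbit_eq]
      rintro ⟨g, hg⟩
      -- Vertices of the hexagon have a zero coordinate, carried by `g` from index 1. On the wall
      -- `k₁ = k₃ + n` the only coordinate of `hat k` that can vanish is `k₂ - k₁`.
      have h0 : (hat k).1 (g.1 1) = 0 := by
        rw [← hg]
        show (g • _ : Homog ℤ).1 _ = 0
        rw [smul_coord, Perm.inv_def, Equiv.symm_apply_apply, pt_one, mul_zero]
      have h0' : (hat k).1 0 = 0 ∨ (hat k).1 1 = 0 ∨ (hat k).1 2 = 0 := by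
        generalize g.1 1 = i at h0
        fin_cases i
        exacts [Or.inl h0, Or.inr (Or.inl h0), Or.inr (Or.inr h0)]
      simp only [hat, pt_zero, pt_one, pt_two] at h0'
      omega
    · intro hX
      rw [orbit_eq]
      refine ⟨(swap 0 1 * swap 1 2, 1), ?_⟩
      show ((swap 0 1 * swap 1 2, 1) : SignedPerm) • _ = hat k
      rw [smul_rot, homog_ext_iff]
      simp only [hat, pt_zero, pt_one, pt_two]
      omega
  · simp [hZ]

/-- The factor `hexWeight` is the ratio of the stabilizer order over `ℤ` to that modulo `n`: it
corrects for the boundary points of the hexagon that are identified modulo `n`. -/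
theorem ω_hat_mul_stabCard {n : ℕ} (hn : 0 < n) {k : Homog ℤ} (hk : k ∈ Γcc n) :
    ω n (hat k) * stabCard (castH (ZMod n) k) = 12 := by
  have h := ncard_orbit_mul_stabCard k
  have h' : ((orbit k).ncard : ℝ) * stabCard k = 12 := by exact_mod_cast h
  have sk := sum_zero k
  have hk' := hk
  obtain ⟨h1, h2, h3⟩ := hk'
  rw [ω, ncard_orbit_hat, stabCard_castH_Γcc hn hk, hexWeight_hat_Γcc hn hk]
  rw [stabCard_Γcc hk] at h'
  by_cases hX : k.1 0 = k.1 1 <;> by_cases hY : k.1 1 = 0 <;> by_cases hZ : k.1 0 = k.1 2 + n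
  · omega
  all_goals
    revert h'
    repeat (first | rw [if_pos (by omega)] | rw [if_neg (by omega)])
    intro h'
    push_cast at h' ⊢
    linarith

/-! ### Nodes as images of `Γcc n`; cubature as an average over `Homog (ZMod n)` -/

theorem hat_reflect_mem_Υ {n : ℤ} {p : Homog ℤ} (hp : p ∈ Γcc n) :
    hat (((swap 1 2, 1) : SignedPerm) • p) ∈ Υ n := by
  have sp := sum_zero p
  obtain ⟨h1, h2, h3⟩ := hp
  rw [smul_swap12]
  refine ⟨⟨?_, ?_⟩, ?_⟩ <;> simp only [hat, pt_zero, pt_one, pt_two]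
  · exact Int.modEq_iff_dvd.2 ⟨-p.1 1, by omega⟩
  · exact Int.modEq_iff_dvd.2 ⟨-p.1 0, by omega⟩
  · omega

theorem exists_hat_reflect_eq {n : ℤ} {j : Homog ℤ} (hj : j ∈ Υ n) :
    ∃ p ∈ Γcc n, hat (((swap 1 2, 1) : SignedPerm) • p) = j := by
  have sj := sum_zero j
  obtain ⟨⟨h1, h2⟩, h3, h4, h5, h6⟩ := hj
  obtain ⟨a, ha⟩ := Int.modEq_iff_dvd.1 h1
  obtain ⟨b, hb⟩ := Int.modEq_iff_dvd.1 h2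
  -- Here `j₂ - j₁ = 3a`. The witness solves `p₂ - p₃ = j₁`, `p₁ - p₂ = j₂`, whence `3p₂ = j₁ - j₂ =
  -- -3a`.
  refine ⟨pt (j.1 1 - a) (-a) (2 * a - j.1 1) (by ring), ⟨?_, ?_, ?_⟩, ?_⟩
  · simp only [pt_one]; omega
  · simp only [pt_zero, pt_one]; omega
  · simp only [pt_zero, pt_two]; omega
  · rw [smul_swap12, homog_ext_iff]
    simp only [hat, pt_zero, pt_one, pt_two]
    omega

instance {R : Type} [CommRing R] [Fintype R] : Fintype (Homog R) :=
  Fintype.ofEquiv (R × R)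
    { toFun := fun p => pt p.1 p.2 (-p.1 - p.2) (by ring)
      invFun := fun t => (t.1 0, t.1 1)
      left_inv := fun _ => rfl
      right_inv := fun _ => homog_ext rfl rfl }

theorem sum_homog {R : Type} [CommRing R] [Fintype R] {M : Type*} [AddCommMonoid M]
    (F : Homog R → M) : ∑ v, F v = ∑ a : R, ∑ b : R, F (pt a b (-a - b) (by ring)) := by
  rw [← Fintype.sum_prod_type' (f := fun a b : R => F (pt a b (-a - b) (by ring)))]
  exact (Fintype.sum_equiv
    ({ toFun := fun p => pt p.1 p.2 (-p.1 - p.2) (by ring)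
       invFun := fun t => (t.1 0, t.1 1)
       left_inv := fun _ => rfl
       right_inv := fun _ => homog_ext rfl rfl } : R × R ≃ Homog R) _ _ (fun _ => rfl)).symm

/-- The form is unimodular, hence nondegenerate modulo every `n`, including multiples of 3, where
the dot product on the plane is degenerate. -/
theorem sum_addChar_symp {n : ℕ} [NeZero n] (a : Homog (ZMod n)) :
    ∑ v : Homog (ZMod n), ZMod.stdAddChar (symp a v) = if a = 0 then (n : ℂ) ^ 2 else 0 := by
  rw [sum_homog]
  have h : ∀ x y : ZMod n, ZMod.stdAddChar (symp a (pt x y (-x - y) (by ring))) =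
      ZMod.stdAddChar (x * a.1 1) * ZMod.stdAddChar (y * -a.1 0) := by
    intro x y
    rw [← AddChar.map_add_eq_mul]
    congr 1
    simp only [symp, pt_zero, pt_one]
    ring
  have hp := ZMod.isPrimitive_stdAddChar n
  simp only [h, ← Finset.mul_sum, ← Finset.sum_mul, AddChar.sum_mulShift _ hp, ZMod.card,
    neg_eq_zero, homog_ext_iff]
  show _ = if a.1 0 = 0 ∧ a.1 1 = 0 then _ else _
  by_cases h0 : a.1 0 = 0 <;> by_cases h1 : a.1 1 = 0 <;> simp [h0, h1, sq]

theorem ω_hat_eq_ncard_orbit {n : ℕ} (hn : 0 < n) {p : Homog ℤ} (hp : p ∈ Γcc n) :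
    ω n (hat p) = (orbit (castH (ZMod n) p)).ncard := by
  have h1 := ω_hat_mul_stabCard hn hp
  have h2 : ((orbit (castH (ZMod n) p)).ncard : ℝ) * stabCard (castH (ZMod n) p) = 12 := by
    exact_mod_cast ncard_orbit_mul_stabCard (castH (ZMod n) p)
  have h0 : (stabCard (castH (ZMod n) p) : ℝ) ≠ 0 := by
    intro h0
    rw [h0] at h2
    norm_num at h2
  exact mul_right_cancel₀ h0 (h1.trans h2.symm)

/-- The fibres of the map to representatives are the orbits, whose sizes are the weights. -/
theorem sum_ω_hat {n : ℕ} [NeZero n] (A : Finset (Homog ℤ)) (hA : ∀ p, p ∈ A ↔ p ∈ Γcc n)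
    (F : Homog (ZMod n) → ℂ) (hF : ∀ (g : SignedPerm) x, F (g • x) = F x) :
    ∑ p ∈ A, (ω n (hat p) : ℂ) * F (castH (ZMod n) p) = ∑ x, F x := by
  classical
  have hn : 0 < n := Nat.pos_of_neZero n
  choose r hr g hg using exists_mem_Γcc (n := n) hn
  rw [← Finset.sum_fiberwise_of_maps_to (s := Finset.univ) (t := A) (g := r)
    (fun x _ => (hA _).2 (hr x))]
  refine Finset.sum_congr rfl fun p hp => ?_
  have hp' := (hA p).1 hp
  rw [Finset.sum_congr rfl (g := fun _ => F (castH (ZMod n) p))]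
  · have hset : orbit (castH (ZMod n) p) =
        ((Finset.univ.filter fun x => r x = p : Finset (Homog (ZMod n))) :
          Set (Homog (ZMod n))) := by
      ext x
      rw [orbit_eq]
      simp only [Finset.coe_filter, Finset.mem_univ, true_and, Set.mem_ofPred_eq]
      constructor
      · rintro ⟨h, rfl⟩
        refine castH_smul_eq_imp_eq (hr _) hp' hn (h⁻¹ * g (h • castH (ZMod n) p)) ?_
        rw [castH_smul, mul_smul, hg, inv_smul_smul]
      · rintro rfl
        exact ⟨g x, hg x⟩
    rw [Finset.sum_const, nsmul_eq_mul, ω_hat_eq_ncard_orbit hn hp', hset,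
      Set.ncard_coe_finset, Complex.ofReal_natCast]
  · intro x hx
    have h := hF (g x) (castH (ZMod n) (r x))
    rwa [hg, (Finset.mem_filter.1 hx).2] at h

theorem cubature_eq {n : ℕ} [NeZero n] (f : Homog ℝ → ℂ) (F : Homog (ZMod n) → ℂ)
    (hF : ∀ (g : SignedPerm) x, F (g • x) = F x)
    (hf : ∀ p, f (node n (hat p)) = F (castH (ZMod n) p)) :
    cubature n f = 1 / (n : ℂ) ^ 2 * ∑ x, F x := by
  classical
  -- Without this reflection `hat` sends `Γcc n` to another image of the node triangle; weights and
  -- values of `F` do not change under it.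
  let τ : SignedPerm := (swap 1 2, 1)
  have hinj : Function.Injective fun p : Homog ℤ => hat (τ • p) :=
    hat_injective.comp (MulAction.injective τ)
  have himg : ((fun p : Homog ℤ => hat (τ • p)) '' Γcc n) = Υ n := by
    ext j
    constructor
    · rintro ⟨p, hp, rfl⟩
      exact hat_reflect_mem_Υ hp
    · exact exists_hat_reflect_eq
  have hfin : (Γcc (n : ℤ)).Finite :=
    Set.Finite.of_finite_image (himg ▸ Υ_finite n) hinj.injOn
  have hΥ : (Υ_finite n).toFinset = hfin.toFinset.image fun p => hat (τ • p) := by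
    ext j
    rw [Set.Finite.mem_toFinset, ← himg]
    simp
  rw [cubature, hΥ, Finset.sum_image hinj.injOn, ← sum_ω_hat hfin.toFinset (by simp) F hF]
  simp only [Int.cast_natCast]
  congr 1
  refine Finset.sum_congr rfl fun p _ => ?_
  rw [hf, castH_smul, hF, hat_smul, ω_smul]

/-! ### Symmetrized characters and their discrete orthogonality -/

section TrigSum

variable {R : Type} [CommRing R]

/-- The automorphism of the group of signed permutations that corresponds to `hat`. -/
def twist (g : SignedPerm) : SignedPerm := (g.1, g.2 * Perm.sign g.1)

/-- Moving `g` across the form gives `g⁻¹` times the sign of its permutation, and that is the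
inverse of `twist g`. -/
theorem symp_smul_right (g : SignedPerm) (k v : Homog R) :
    symp k (g • v) = symp ((twist g)⁻¹ • k) v := by
  have h := symp_smul g ((twist g)⁻¹ • k) v
  have h2 : g • (twist g)⁻¹ • k = ((1, Perm.sign g.1) : SignedPerm) • k := by
    rw [smul_smul]
    congr 1
    ext1
    · simp [twist]
    · simp only [twist, Prod.snd_mul, Prod.snd_inv, Int.units_inv_eq_self]
      rw [← mul_assoc, Int.units_mul_self, one_mul]
  have h3 : symp (((1, Perm.sign g.1) : SignedPerm) • k) (g • v) =
      ((Perm.sign g.1 : ℤ) : R) * symp k (g • v) := by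
    simp only [symp, smul_coord]
    simp
    ring
  rw [h2, h3] at h
  rcases Int.units_eq_one_or (Perm.sign g.1) with hs | hs <;> rw [hs] at h <;> simpa using h

/-- The (anti)symmetrization of a character with respect to the sign character `s`. -/
def trigSum (ψ : AddChar R ℂ) (s : SignedPerm →* ℤˣ) (k v : Homog R) : ℂ :=
  1 / 12 * ∑ g, ((s g : ℤ) : ℂ) * ψ (symp (g • k) v)

theorem trigSum_smul (ψ : AddChar R ℂ) (s : SignedPerm →* ℤˣ) (k v : Homog R)
    (g : SignedPerm) :
    trigSum ψ s k (g • v) = ((s (twist g) : ℤ) : ℂ) * trigSum ψ s k v := by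
  rw [trigSum, trigSum, mul_left_comm]
  congr 1
  rw [Finset.mul_sum]
  refine Fintype.sum_equiv (Equiv.mulLeft (twist g)⁻¹) _ _ fun h => ?_
  rw [symp_smul_right, Equiv.coe_mulLeft, ← mul_assoc, mul_smul]
  congr 1
  rw [← Int.cast_mul, ← Units.val_mul, ← map_mul, mul_inv_cancel_left]

end TrigSum

theorem sign_mul_conj (ε : ℤˣ) : ((ε : ℤ) : ℂ) * starRingEnd ℂ ((ε : ℤ) : ℂ) = 1 := by
  rcases Int.units_eq_one_or ε with h | h <;> simp [h]

theorem sum_trigSum_mul_conj {n : ℕ} [NeZero n] (s : SignedPerm →* ℤˣ) (j k : Homog (ZMod n)) :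
    ∑ x, trigSum ZMod.stdAddChar s j x * starRingEnd ℂ (trigSum ZMod.stdAddChar s k x) =
      (n : ℂ) ^ 2 / 144 * ∑ g : SignedPerm, ∑ h : SignedPerm,
        ((s g : ℤ) : ℂ) * ((s h : ℤ) : ℂ) * if g • j = h • k then 1 else 0 := by
  have h1 : ∀ (g h : SignedPerm) (x : Homog (ZMod n)),
      ((s g : ℤ) : ℂ) * ZMod.stdAddChar (symp (g • j) x) *
        starRingEnd ℂ (((s h : ℤ) : ℂ) * ZMod.stdAddChar (symp (h • k) x)) =
      ((s g : ℤ) : ℂ) * ((s h : ℤ) : ℂ) * ZMod.stdAddChar (symp (g • j - h • k) x) := by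
    intro g h x
    have h2 : symp (g • j - h • k) x = symp (g • j) x + -symp (h • k) x := by
      simp only [symp, Submodule.coe_sub, Pi.sub_apply]
      ring
    rw [h2, AddChar.map_add_eq_mul, AddChar.map_neg_eq_conj, map_mul, map_intCast]
    ring
  have h3 : ∀ x : Homog (ZMod n), trigSum ZMod.stdAddChar s j x *
      starRingEnd ℂ (trigSum ZMod.stdAddChar s k x) =
      1 / 144 * ∑ g : SignedPerm, ∑ h : SignedPerm,
        ((s g : ℤ) : ℂ) * ((s h : ℤ) : ℂ) * ZMod.stdAddChar (symp (g • j - h • k) x) := by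
    intro x
    rw [trigSum, trigSum, map_mul, map_sum, mul_mul_mul_comm, Finset.sum_mul_sum]
    congr 1
    · rw [map_div₀, map_one, map_ofNat]
      norm_num
    · exact Finset.sum_congr rfl fun g _ => Finset.sum_congr rfl fun h _ => h1 g h x
  rw [Finset.sum_congr rfl fun x _ => h3 x, ← Finset.mul_sum,
    show (n : ℂ) ^ 2 / 144 = 1 / 144 * (n : ℂ) ^ 2 by ring, mul_assoc]
  congr 1
  rw [Finset.sum_comm, Finset.mul_sum]
  refine Finset.sum_congr rfl fun g _ => ?_
  rw [Finset.sum_comm, Finset.mul_sum]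
  refine Finset.sum_congr rfl fun h _ => ?_
  rw [← Finset.mul_sum, sum_addChar_symp]
  simp only [sub_eq_zero]
  split_ifs <;> ring

/-- For `j ≠ k` no coincidence `g • j = h • k` occurs modulo `n`. For `j = k` each `g` contributes
the stabilizer order, and `stabCard / 12` is the reciprocal of the weight. -/
theorem sum_trigSum_mul_conj_Γcc {n : ℕ} [NeZero n] (s : SignedPerm →* ℤˣ) {j k : Homog ℤ}
    (hj : j ∈ Γcc n) (hk : k ∈ Γcc n)
    (hs : ∀ g : SignedPerm, g • castH (ZMod n) k = castH (ZMod n) k → s g = 1) :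
    1 / (n : ℂ) ^ 2 * ∑ x, trigSum ZMod.stdAddChar s (castH (ZMod n) j) x *
      starRingEnd ℂ (trigSum ZMod.stdAddChar s (castH (ZMod n) k) x) =
      (if j = k then 1 else 0) / (ω n (hat k) : ℂ) := by
  have hn : 0 < n := Nat.pos_of_neZero n
  have hn0 : (n : ℂ) ≠ 0 := by exact_mod_cast hn.ne'
  rw [sum_trigSum_mul_conj]
  split_ifs with hjk
  · subst hjk
    have h1 : ∀ g : SignedPerm, ∑ h : SignedPerm, ((s g : ℤ) : ℂ) * ((s h : ℤ) : ℂ) *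
        (if g • castH (ZMod n) j = h • castH (ZMod n) j then (1 : ℂ) else 0) =
        stabCard (castH (ZMod n) j) := by
      intro g
      rw [stabCard, Nat.cast_sum]
      -- A coincidence means that `g⁻¹ * h` fixes `j` modulo `n`; then `hs` gives `s g = s h`, so
      -- the signs cancel.
      refine Fintype.sum_equiv (Equiv.mulLeft g⁻¹) _ _ fun h => ?_
      rw [Equiv.coe_mulLeft]
      have hiff : (g⁻¹ * h) • castH (ZMod n) j = castH (ZMod n) j ↔
          g • castH (ZMod n) j = h • castH (ZMod n) j := by
        rw [mul_smul, inv_smul_eq_iff, eq_comm]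
      by_cases he : g • castH (ZMod n) j = h • castH (ZMod n) j
      · rw [if_pos he, if_pos (hiff.2 he)]
        have h2 := hs (g⁻¹ * h) (hiff.2 he)
        rw [map_mul, map_inv, inv_mul_eq_one] at h2
        rw [h2, mul_one, ← Int.cast_mul, ← Units.val_mul, Int.units_mul_self]
        simp
      · rw [if_neg he, if_neg (mt hiff.1 he)]
        simp
    have h3 : (ω n (hat j) : ℂ) * stabCard (castH (ZMod n) j) = 12 := by
      exact_mod_cast congrArg (Complex.ofReal) (ω_hat_mul_stabCard hn hj)
    have h4 : (ω n (hat j) : ℂ) ≠ 0 := by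
      intro h
      rw [h] at h3
      norm_num at h3
    rw [Finset.sum_congr rfl fun g _ => h1 g, Finset.sum_const, Finset.card_univ,
      card_signedPerm, nsmul_eq_mul]
    field_simp
    push_cast
    linear_combination 12 * h3
  · rw [Finset.sum_eq_zero, mul_zero, mul_zero, zero_div]
    intro g _
    refine Finset.sum_eq_zero fun h _ => ?_
    rw [if_neg, mul_zero]
    intro he
    exact hjk (castH_smul_eq_imp_eq hj hk hn (h⁻¹ * g)
      (by rw [castH_smul, mul_smul, he, inv_smul_smul]))

/-! ### The functions `CC`, `SC`, `CS`, `SS` as symmetrized characters -/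

/-- The character `x ↦ exp (2πix)` of the real line. -/
def expChar : AddChar ℝ ℂ where
  toFun x := Complex.exp (2 * Real.pi * Complex.I * x)
  map_zero_eq_one' := by simp
  map_add_eq_mul' x y := by
    rw [← Complex.exp_add]
    push_cast
    ring_nf

theorem expChar_apply (x : ℝ) : expChar x = Complex.exp (2 * Real.pi * Complex.I * x) := rfl

/-- The sign of the permutation. -/
def permSign : SignedPerm →* ℤˣ := Perm.sign.comp (MonoidHom.fst _ _)

/-- The scalar sign. -/
def scalarSign : SignedPerm →* ℤˣ := MonoidHom.snd _ _

theorem permSign_apply (g : SignedPerm) : permSign g = Perm.sign g.1 := rfl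

theorem scalarSign_apply (g : SignedPerm) : scalarSign g = g.2 := rfl

/-- Composing the operators gives 36 terms in which each of the twelve group elements occurs three
times. -/
theorem opPstar_opP (ε δ : ℂ) (f : Homog ℝ → ℂ) (t : Homog ℝ) :
    opPstar δ (opP ε f) t = 1 / 12 *
      (f (((1, 1) : SignedPerm) • t) + f (((swap 0 1 * swap 1 2, 1) : SignedPerm) • t) +
        f (((swap 1 2 * swap 0 1, 1) : SignedPerm) • t) +
      δ * (f (((swap 0 1, 1) : SignedPerm) • t) + f (((swap 0 2, 1) : SignedPerm) • t) +
        f (((swap 1 2, 1) : SignedPerm) • t)) +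
      ε * (f (((swap 0 1, -1) : SignedPerm) • t) + f (((swap 0 2, -1) : SignedPerm) • t) +
        f (((swap 1 2, -1) : SignedPerm) • t)) +
      δ * ε * (f (((1, -1) : SignedPerm) • t) +
        f (((swap 0 1 * swap 1 2, -1) : SignedPerm) • t) +
        f (((swap 1 2 * swap 0 1, -1) : SignedPerm) • t))) := by
  have ht : f t = f (pt (t.1 0) (t.1 1) (t.1 2) t.2) := by rw [pt_self]
  have hn : f (-t) = f (pt (-t.1 0) (-t.1 1) (-t.1 2) (by linear_combination -sum_zero t)) := by
    rw [← neg_pt (t.1 0) (t.1 1) (t.1 2) t.2, pt_self]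
  simp only [smul_mk_neg_one_eq, smul_one_one, smul_swap01, smul_swap02, smul_swap12, smul_rot,
    smul_rot_inv, opPstar, opP, σ₁σ₂, σ₂σ₁, σ₁, σ₂, σ₃, neg_pt, pt_zero, pt_one, pt_two, neg_neg,
    ht, hn]
  ring

theorem φ_smul (g : SignedPerm) (k : Homog ℤ) (v : Homog ℝ) :
    φ k (g • hat v) = expChar (symp (g⁻¹ • castH ℝ k) v) := by
  have h := dot_smul g (castH ℝ k) (hat v)
  rw [dot_hat] at h
  simp only [castH_coord] at h
  rw [φ, h, expChar_apply]
  congr 1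
  push_cast
  ring

/-- Parity and scalar split the group into four classes of three elements. Since `σᵢ` is minus a
transposition, `ε` belongs to odd permutations with scalar `-1` and `δ` to odd ones with scalar `1`.
-/
theorem opPstar_opP_φ (ε δ : ℂ) (s : SignedPerm →* ℤˣ) (k : Homog ℤ) (v : Homog ℝ)
    (hδ : ∀ π, Perm.sign π = -1 → ((s (π, 1) : ℤ) : ℂ) = δ)
    (hε : ∀ π, Perm.sign π = -1 → ((s (π, -1) : ℤ) : ℂ) = ε)
    (h1 : ∀ π, Perm.sign π = 1 → ((s (π, 1) : ℤ) : ℂ) = 1)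
    (hδε : ∀ π, Perm.sign π = 1 → ((s (π, -1) : ℤ) : ℂ) = δ * ε) :
    opPstar δ (opP ε (φ k)) (hat v) = trigSum expChar s (castH ℝ k) v := by
  have hsum : trigSum expChar s (castH ℝ k) v =
      1 / 12 * ∑ g, ((s g : ℤ) : ℂ) * φ k (g • hat v) := by
    rw [trigSum]
    congr 1
    refine Fintype.sum_equiv (Equiv.inv SignedPerm) _ _ fun g => ?_
    rw [φ_smul, Equiv.inv_apply, inv_inv, map_inv, Int.units_inv_eq_self]
  rw [hsum, opPstar_opP, signedPerm_sum, perm_sum, perm_sum]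
  have s3 : Perm.sign (swap (0 : Fin 3) 1) = -1 := by decide
  have s4 : Perm.sign (swap (0 : Fin 3) 2) = -1 := by decide
  have s5 : Perm.sign (swap (1 : Fin 3) 2) = -1 := by decide
  have s6 : Perm.sign (swap (0 : Fin 3) 1 * swap 1 2) = 1 := by decide
  have s7 : Perm.sign (swap (1 : Fin 3) 2 * swap 0 1) = 1 := by decide
  rw [h1 _ Perm.sign_one, h1 _ s6, h1 _ s7, hδ _ s3, hδ _ s4, hδ _ s5, hε _ s3, hε _ s4, hε _ s5,
    hδε _ Perm.sign_one, hδε _ s6, hδε _ s7]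
  ring

theorem CC_hat (k : Homog ℤ) (v : Homog ℝ) :
    CC k (hat v) = trigSum expChar 1 (castH ℝ k) v := by
  refine opPstar_opP_φ _ _ _ _ _ ?_ ?_ ?_ ?_ <;> simp

theorem SC_hat (k : Homog ℤ) (v : Homog ℝ) :
    SC k (hat v) = 1 / Complex.I * trigSum expChar (scalarSign * permSign) (castH ℝ k) v := by
  rw [SC, opPstar_opP_φ] <;> simp +contextual [permSign_apply, scalarSign_apply]

theorem CS_hat (k : Homog ℤ) (v : Homog ℝ) :
    CS k (hat v) = 1 / Complex.I * trigSum expChar scalarSign (castH ℝ k) v := by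
  rw [CS, opPstar_opP_φ] <;> simp +contextual [scalarSign_apply]

theorem SS_hat (k : Homog ℤ) (v : Homog ℝ) :
    SS k (hat v) = -trigSum expChar permSign (castH ℝ k) v := by
  rw [SS, opPstar_opP_φ] <;> simp +contextual [permSign_apply]

theorem trigSum_node {n : ℕ} [NeZero n] (s : SignedPerm →* ℤˣ) (k p : Homog ℤ) :
    trigSum expChar s (castH ℝ k) ((n : ℝ)⁻¹ • castH ℝ p) =
      trigSum ZMod.stdAddChar s (castH (ZMod n) k) (castH (ZMod n) p) := by
  rw [trigSum, trigSum]
  congr 1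
  refine Finset.sum_congr rfl fun g _ => ?_
  have h : symp (g • castH ℝ k) ((n : ℝ)⁻¹ • castH ℝ p) = (symp (g • k) p : ℤ) / (n : ℝ) := by
    rw [← symp_castH, castH_smul]
    simp only [symp, Submodule.coe_smul, Pi.smul_apply, smul_eq_mul]
    ring
  rw [h, ← castH_smul, symp_castH, ZMod.stdAddChar_coe, expChar_apply]
  congr 2
  push_cast
  ring

theorem node_hat (n : ℕ) (p : Homog ℤ) :
    node n (hat p) = hat ((n : ℝ)⁻¹ • castH ℝ p) := by
  apply homog_ext <;>
  simp [node, hat, castH_coord] <;> ring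

/-- The constant `c` of modulus one is the normalization `1`, `1/i` or `-1`. The product of one
function with the conjugate of the other is invariant, as their signs under `g` coincide. -/
theorem discreteInner_eq {n : ℕ} [NeZero n] (s : SignedPerm →* ℤˣ) (c : ℂ)
    (hc : c * starRingEnd ℂ c = 1) (f : Homog ℤ → Homog ℝ → ℂ)
    (hf : ∀ k v, f k (hat v) = c * trigSum expChar s (castH ℝ k) v) {j k : Homog ℤ}
    (hj : j ∈ Γcc n) (hk : k ∈ Γcc n)
    (hs : ∀ g : SignedPerm, g • castH (ZMod n) k = castH (ZMod n) k → s g = 1) :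
    discreteInner n (f j) (f k) =
        (if j = k then 1 else 0) / (hexWeight n (hat k) * (orbit k).ncard : ℝ) ∧
      discreteInner n (f j) (f k) = (if j = k then 1 else 0) / (ω n (hat k) : ℂ) := by
  have h : discreteInner n (f j) (f k) = (if j = k then 1 else 0) / (ω n (hat k) : ℂ) := by
    rw [← sum_trigSum_mul_conj_Γcc s hj hk hs]
    refine cubature_eq _ _ (fun g x => ?_) (fun p => ?_)
    · rw [trigSum_smul, trigSum_smul, map_mul, mul_mul_mul_comm, sign_mul_conj, one_mul]
    · simp only [node_hat, hf, trigSum_node, map_mul]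
      rw [mul_mul_mul_comm, hc, one_mul]
  exact ⟨by rw [h, ω, ncard_orbit_hat], h⟩

theorem I_inv_mul_conj : 1 / Complex.I * starRingEnd ℂ (1 / Complex.I) = 1 := by
  simp

theorem Γsc_subset (n : ℤ) : Γsc n ⊆ Γcc n := fun _ h => ⟨h.1, h.2.1.le, h.2.2.le⟩
theorem Γcs_subset (n : ℤ) : Γcs n ⊆ Γcc n := fun _ h => ⟨h.1.le, h.2⟩
theorem Γss_subset (n : ℤ) : Γss n ⊆ Γcc n := fun _ h => ⟨h.1.le, h.2.1.le, h.2.2.le⟩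

/-! ### Stabilizers for the remaining index sets, and the cubature sum of `CC k` -/

/-- Only the wall `k₂ = 0` remains, with mirror `(swap 0 2, -1)`, on which `scalarSign * permSign`
is 1. -/
theorem stabilizer_Γsc {n : ℕ} (hn : 0 < n) {k : Homog ℤ} (hk : k ∈ Γsc n) (g : SignedPerm) :
    g • castH (ZMod n) k = castH (ZMod n) k → g = 1 ∨ g = (swap 0 2, -1) := by
  have sk := sum_zero k
  have hk' := Γsc_subset _ hk
  obtain ⟨h1, h2, h3⟩ := hk
  refine signedPerm_cases (p := fun g => g • castH (ZMod n) k = castH (ZMod n) k →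
    g = 1 ∨ g = (swap 0 2, -1)) ?_ ?_ g <;>
  refine perm_cases ?_ ?_ ?_ ?_ ?_ ?_ <;>
  first
  | (intro; left; rfl)
  | (intro; right; rfl)
  | (rw [zmod_smul_eq_self_iff hn hk']
     intro hg
     simp only [smul_mk_neg_one_eq, smul_one_one, smul_swap01, smul_swap02, smul_swap12, smul_rot,
       smul_rot_inv, neg_pt, pt_zero, pt_one, coord_neg] at hg
     omega)

theorem stabilizer_Γcs {n : ℕ} (hn : 0 < n) {k : Homog ℤ} (hk : k ∈ Γcs n) (g : SignedPerm) :
    g • castH (ZMod n) k = castH (ZMod n) k → g.2 = 1 := by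
  have sk := sum_zero k
  have hk' := Γcs_subset _ hk
  obtain ⟨h1, h2, h3⟩ := hk
  refine signedPerm_cases (p := fun g => g • castH (ZMod n) k = castH (ZMod n) k → g.2 = 1)
    (fun _ _ => rfl) ?_ g
  refine perm_cases ?_ ?_ ?_ ?_ ?_ ?_ <;>
  (rw [zmod_smul_eq_self_iff hn hk']
   intro hg
   simp only [smul_mk_neg_one_eq, smul_one_one, smul_swap01, smul_swap02, smul_swap12, smul_rot,
     smul_rot_inv, neg_pt, pt_zero, pt_one, coord_neg] at hg
   omega)

theorem stabilizer_Γss {n : ℕ} (hn : 0 < n) {k : Homog ℤ} (hk : k ∈ Γss n) (g : SignedPerm)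
    (hg : g • castH (ZMod n) k = castH (ZMod n) k) : g = 1 := by
  have h2 := stabilizer_Γcs hn ⟨hk.1, hk.2.1.le, hk.2.2.le⟩ g hg
  rcases stabilizer_Γsc hn ⟨hk.1.le, hk.2⟩ g hg with h | h
  · exact h
  · rw [h] at h2
    exact absurd h2 (by decide)

theorem ω_hat_Γss {n : ℕ} (hn : 0 < n) {k : Homog ℤ} (hk : k ∈ Γss n) : ω n (hat k) = 12 := by
  have h := ω_hat_mul_stabCard hn (Γss_subset _ hk)
  obtain ⟨h1, h2, h3⟩ := hk
  rw [stabCard_castH_Γcc hn ⟨h1.le, h2.le, h3.le⟩, if_neg (by omega), if_neg (by omega),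
    if_neg (by omega), if_neg (by omega)] at h
  simpa using h

theorem cubature_CC {n : ℕ} [NeZero n] (k : Homog ℤ) :
    cubature n (CC k) = if castH (ZMod n) k = 0 then 1 else 0 := by
  have hn0 : (n : ℂ) ≠ 0 := by exact_mod_cast NeZero.ne n
  rw [cubature_eq (CC k) (trigSum ZMod.stdAddChar 1 (castH (ZMod n) k))
    (fun g x => by rw [trigSum_smul]; simp) (fun p => by rw [node_hat, CC_hat, trigSum_node])]
  have h0 : ∀ g : SignedPerm, g • castH (ZMod n) k = 0 ↔ castH (ZMod n) k = 0 := by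
    intro g
    have h : g • (0 : Homog (ZMod n)) = 0 := by
      ext i
      simp [smul_coord]
    rw [smul_eq_iff_eq_inv_smul, ← h, inv_smul_smul, h]
  simp only [trigSum, ← Finset.mul_sum]
  rw [Finset.sum_comm]
  simp only [← Finset.mul_sum, sum_addChar_symp, h0]
  rw [← Finset.sum_mul]
  split_ifs
  · simp only [MonoidHom.one_apply, Units.val_one, Int.cast_one, Finset.sum_const,
      Finset.card_univ, card_signedPerm]
    field_simp
    norm_num
  · simp

/-! ### Explicit values of the weights -/

section Weights

variable {n : ℕ} {j p : Homog ℤ}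

/-- Reads the position of `j` on the chamber: `j₂ = 0` means `p₁ = p₂`, `j₁ = j₂` means `p₂ = 0`,
and `-j₃ = n` means `p₁ = p₃ + n`. -/
theorem exists_ω_mul_stabCard (hn : 0 < n) (hj : j ∈ Υ n) :
    ∃ p ∈ Γcc (n : ℤ), (j.1 0 = p.1 1 - p.1 2 ∧ j.1 1 = p.1 0 - p.1 1 ∧
      j.1 2 = p.1 2 - p.1 0) ∧ ω n j * stabCard (castH (ZMod n) p) = 12 := by
  obtain ⟨p, hp, rfl⟩ := exists_hat_reflect_eq hj
  refine ⟨p, hp, ?_, ?_⟩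
  · rw [smul_swap12]
    exact ⟨rfl, rfl, rfl⟩
  · rw [hat_smul, ω_smul, ω_hat_mul_stabCard hn hp]

theorem ω_interior (hn : 0 < n) (hj : j ∈ Υint n) : ω n j = 12 := by
  obtain ⟨hH, h1, h2, h3, h4⟩ := hj
  obtain ⟨p, hp, hjp, h⟩ := exists_ω_mul_stabCard hn ⟨hH, h1.le, h2.le, h3.le, h4.le⟩
  have sp := sum_zero p
  rw [stabCard_castH_Γcc hn hp, if_neg (by omega), if_neg (by omega), if_neg (by omega),
    if_neg (by omega)] at h
  push_cast at h
  linarith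

theorem ω_zero (hn : 0 < n) : ω n 0 = 1 := by
  have h0 : (0 : Homog ℤ) ∈ Υ n := ⟨⟨rfl, rfl⟩, le_rfl, le_rfl, by simp, by simp⟩
  obtain ⟨p, hp, ⟨h1, h2, h3⟩, h⟩ := exists_ω_mul_stabCard hn h0
  have sp := sum_zero p
  simp only [Submodule.coe_zero, Pi.zero_apply] at h1 h2 h3
  rw [stabCard_castH_Γcc hn hp, if_pos (by omega)] at h
  push_cast at h
  linarith

theorem ω_vertex (hn : 0 < n) (hj : j ∈ Υ n) (h0 : j.1 0 = n) (h1 : j.1 1 = 0) :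
    ω n j = 2 := by
  obtain ⟨p, hp, hjp, h⟩ := exists_ω_mul_stabCard hn hj
  have sp := sum_zero p
  rw [stabCard_castH_Γcc hn hp, if_neg (by omega), if_pos (by omega)] at h
  push_cast at h
  linarith

theorem ω_midpoint (hn : 0 < n) (hj : j ∈ Υ n) (h0 : 2 * j.1 0 = n) (h1 : 2 * j.1 1 = n) :
    ω n j = 3 := by
  obtain ⟨p, hp, hjp, h⟩ := exists_ω_mul_stabCard hn hj
  have sp := sum_zero p
  rw [stabCard_castH_Γcc hn hp, if_neg (by omega), if_neg (by omega), if_pos (by omega)] at h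
  push_cast at h
  linarith

theorem ω_side (hn : 0 < n) (hj : j ∈ Υ n) (hint : j ∉ Υint n) (h0 : j ≠ 0)
    (h1 : ¬ (j.1 0 = n ∧ j.1 1 = 0 ∧ j.1 2 = -n))
    (h2 : ¬ (2 * j.1 0 = n ∧ 2 * j.1 1 = n ∧ j.1 2 = -n)) : ω n j = 6 := by
  obtain ⟨p, hp, hjp, h⟩ := exists_ω_mul_stabCard hn hj
  have sp := sum_zero p
  obtain ⟨hp1, hp2, hp3⟩ := id hp
  have hi : ¬ (0 < j.1 1 ∧ j.1 1 < j.1 0 ∧ j.1 0 < -j.1 2 ∧ -j.1 2 < n) :=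
    fun hi => hint ⟨hj.1, hi⟩
  have h0' : ¬ (j.1 0 = 0 ∧ j.1 1 = 0) := fun h' => h0 (homog_ext h'.1 h'.2)
  rw [stabCard_castH_Γcc hn hp, if_neg (by omega), if_neg (by omega), if_neg (by omega),
    if_pos (by omega)] at h
  push_cast at h
  linarith

end Weights

/-! ### The integral over the triangle -/

open Set

/-- The affine self-map of the plane with linear part `!![a, b; c, d]` and translation `(e, f)`. -/
def affineMap (a b c d e f : ℝ) (u : ℝ × ℝ) : ℝ × ℝ :=
  (a * u.1 + b * u.2 + e, c * u.1 + d * u.2 + f)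

theorem continuous_affineMap (a b c d e f : ℝ) : Continuous (affineMap a b c d e f) := by
  unfold affineMap
  fun_prop

theorem map_affineMap {a b c d : ℝ} (e f : ℝ) (h : a * d - b * c ≠ 0) :
    (volume : Measure (ℝ × ℝ)).map (affineMap a b c d e f) =
      ENNReal.ofReal |(a * d - b * c)⁻¹| • volume := by
  let B := Module.Basis.finTwoProd ℝ
  let L : ℝ × ℝ →ₗ[ℝ] ℝ × ℝ := Matrix.toLin B B !![a, b; c, d]
  have hL : LinearMap.det L = a * d - b * c := by
    rw [LinearMap.det_toLin, Matrix.det_fin_two_of]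
  have hLa : ∀ u, L u = (a * u.1 + b * u.2, c * u.1 + d * u.2) := by
    intro u
    exact Matrix.toLin_finTwoProd_apply a b c d u
  have hcomp : affineMap a b c d e f = (fun u => u + (e, f)) ∘ L := by
    funext u
    simp [hLa, affineMap]
  have hLm : Measurable L := (LinearMap.continuous_of_finiteDimensional L).measurable
  rw [hcomp, ← Measure.map_map (measurable_add_const _) hLm,
    Measure.map_linearMap_addHaar_eq_smul_addHaar volume (by rw [hL]; exact h), hL,
    Measure.map_smul, (measurePreserving_add_right volume ((e, f) : ℝ × ℝ)).map_eq]

theorem affineMap_injective {a b c d : ℝ} (e f : ℝ) (h : a * d - b * c ≠ 0) :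
    Function.Injective (affineMap a b c d e f) := by
  intro u v huv
  simp only [affineMap, Prod.mk.injEq] at huv
  obtain ⟨h1, h2⟩ := huv
  ext
  · refine mul_left_cancel₀ h ?_
    linear_combination d * h1 - b * h2
  · refine mul_left_cancel₀ h ?_
    linear_combination a * h2 - c * h1

theorem setIntegral_comp_affineMap {a b c d : ℝ} (e f : ℝ) (h : a * d - b * c ≠ 0)
    (S : Set (ℝ × ℝ)) (F : ℝ × ℝ → ℂ) :
    ∫ u in S, F u =
      |a * d - b * c| • ∫ u in affineMap a b c d e f ⁻¹' S, F (affineMap a b c d e f u) := by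
  have hemb : MeasurableEmbedding (affineMap a b c d e f) :=
    (continuous_affineMap a b c d e f).measurableEmbedding (affineMap_injective e f h)
  rw [← hemb.setIntegral_map, map_affineMap e f h, Measure.restrict_smul, integral_smul_measure,
    ENNReal.toReal_ofReal (abs_nonneg _), smul_smul, abs_inv, mul_inv_cancel₀ (abs_ne_zero.2 h),
    one_smul]

/-- The coordinate description of the triangle. -/
def coordTriangle : Set (ℝ × ℝ) := {u | 0 ≤ u.2 ∧ u.2 ≤ u.1 ∧ 2 * u.1 + u.2 ≤ 1}

theorem volume_graph {f : ℝ → ℝ} (hf : Continuous f) :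
    volume {u : ℝ × ℝ | u.2 = f u.1} = 0 := by
  have hm : MeasurableSet {u : ℝ × ℝ | u.2 = f u.1} :=
    (isClosed_eq continuous_snd (hf.comp continuous_fst)).measurableSet
  rw [Measure.volume_eq_prod, Measure.measure_prod_null hm]
  filter_upwards with x
  have : Prod.mk x ⁻¹' {u : ℝ × ℝ | u.2 = f u.1} = {f x} := by
    ext y; simp
  rw [this]
  exact Real.volume_singleton

/-- Boundary lines are null sets, so it suffices to lie between the open and the closed triangle;
strict and weak inequalities of the pieces need not be tracked. -/
theorem coordTriangle_ae_eq {S : Set (ℝ × ℝ)}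
    (h1 : ∀ u : ℝ × ℝ, 0 < u.2 → u.2 < u.1 → 2 * u.1 + u.2 < 1 → u ∈ S)
    (h2 : S ⊆ coordTriangle) : S =ᵐ[volume] coordTriangle := by
  refine h2.eventuallyLE.antisymm ?_
  rw [ae_le_set]
  have hsub : coordTriangle \ S ⊆ {u : ℝ × ℝ | u.2 = 0} ∪ {u : ℝ × ℝ | u.2 = u.1} ∪
      {u : ℝ × ℝ | u.2 = 1 - 2 * u.1} := by
    rintro u ⟨⟨ha, hb, hc⟩, hS⟩
    by_contra hu
    simp only [mem_union, mem_ofPred_eq, not_or] at hu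
    refine hS (h1 u (lt_of_le_of_ne ha (Ne.symm hu.1.1)) (lt_of_le_of_ne hb hu.1.2)
      (lt_of_le_of_ne hc fun h => hu.2 (by linarith)))
  refine measure_mono_null hsub (measure_union_null (measure_union_null ?_ ?_) ?_)
  · exact volume_graph continuous_const
  · exact volume_graph continuous_id
  · exact volume_graph (f := fun x => 1 - 2 * x) (by fun_prop)

theorem setIntegral_eq_coordTriangle {F : ℝ × ℝ → ℂ} {S : Set (ℝ × ℝ)} (a b c d e f : ℝ)
    (hdet : |a * d - b * c| = 1)
    (hF : ∀ u, F (affineMap a b c d e f u) = F u)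
    (h1 : ∀ u : ℝ × ℝ, 0 < u.2 → u.2 < u.1 → 2 * u.1 + u.2 < 1 → affineMap a b c d e f u ∈ S)
    (h2 : ∀ u, affineMap a b c d e f u ∈ S → u ∈ coordTriangle) :
    ∫ u in S, F u = ∫ u in coordTriangle, F u := by
  have h : a * d - b * c ≠ 0 := by
    rw [← abs_ne_zero, hdet]
    exact one_ne_zero
  rw [setIntegral_comp_affineMap e f h S F, hdet, one_smul]
  simp only [hF]
  exact setIntegral_congr_set (coordTriangle_ae_eq h1 h2)

/-- The point of the plane `t₁ + t₂ + t₃ = 0` with given first two coordinates. -/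
def ofCoord (u : ℝ × ℝ) : Homog ℝ := pt u.1 u.2 (-u.1 - u.2) (by ring)

theorem comp_affineMap {F : Homog ℝ → ℂ}
    (hF : ∀ (g : SignedPerm) (l : Homog ℤ) v, F (g • v + castH ℝ l) = F v)
    (a b c d e f : ℝ) (g : SignedPerm) (x y : ℤ)
    (h : ∀ u, (g • ofCoord u).1 0 + x = a * u.1 + b * u.2 + e ∧
      (g • ofCoord u).1 1 + y = c * u.1 + d * u.2 + f) (u : ℝ × ℝ) :
    F (ofCoord (affineMap a b c d e f u)) = F (ofCoord u) := by
  rw [← hF g (pt x y (-x - y) (by ring)) (ofCoord u)]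
  congr 1
  apply homog_ext
  · exact (h u).1.symm
  · exact (h u).2.symm

/-- The square is a period cell of `Homog ℤ`. The mirrors of the affine reflection group cut it into
twelve chambers, all equivalent to `coordTriangle`. -/
theorem setIntegral_unitSquare {F : Homog ℝ → ℂ} (hc : Continuous fun u => F (ofCoord u))
    (hF : ∀ (g : SignedPerm) (l : Homog ℤ) v, F (g • v + castH ℝ l) = F v) :
    ∫ u in Ioc (0 : ℝ) 1 ×ˢ Ioc (0 : ℝ) 1, F (ofCoord u) =
      12 * ∫ u in coordTriangle, F (ofCoord u) := by
  set G : ℝ × ℝ → ℂ := fun u => F (ofCoord u) with hG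
  set Q : Set (ℝ × ℝ) := Ioc (0 : ℝ) 1 ×ˢ Ioc (0 : ℝ) 1 with hQ
  have hint : ∀ S ⊆ Q, IntegrableOn G S := by
    intro S hS
    refine (hc.continuousOn.integrableOn_compact
      (isCompact_Icc.prod isCompact_Icc : IsCompact (Icc (0 : ℝ) 1 ×ˢ Icc (0 : ℝ) 1))).mono_set
      (hS.trans (prod_mono Ioc_subset_Icc_self Ioc_subset_Icc_self))
  have hsplit : ∀ (S : Set (ℝ × ℝ)) (p q r : ℝ), S ⊆ Q →
      ∫ u in S, G u = (∫ u in S ∩ {u | p * u.1 + q * u.2 ≤ r}, G u) +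
        ∫ u in S \ {u | p * u.1 + q * u.2 ≤ r}, G u := by
    intro S p q r hS
    refine (integral_inter_add_sdiff ?_ (hint S hS)).symm
    exact (isClosed_le (by fun_prop) continuous_const).measurableSet
  have hi : ∀ {S : Set (ℝ × ℝ)} (P : Set (ℝ × ℝ)), S ⊆ Q → S ∩ P ⊆ Q :=
    fun P h => inter_subset_left.trans h
  have hd : ∀ {S : Set (ℝ × ℝ)} (P : Set (ℝ × ℝ)), S ⊆ Q → S \ P ⊆ Q :=
    fun P h => sdiff_subset.trans h
  have q0 := subset_refl Q
  -- Eleven cuts, along the mirrors `u₁ + u₂ = 1`, `u₁ = u₂`, `2u₁ + u₂ = 1, 2` and `u₁ + 2u₂ = 1,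
  -- 2`, leave twelve pieces.
  rw [hsplit Q 1 1 1 q0, hsplit _ (-1) 1 0 (hi _ q0), hsplit _ (-1) 1 0 (hd _ q0),
    hsplit _ 2 1 1 (hi _ (hi _ q0)), hsplit _ 1 2 1 (hd _ (hi _ (hi _ q0))),
    hsplit _ 1 2 1 (hd _ (hi _ q0)), hsplit _ 2 1 1 (hd _ (hd _ (hi _ q0))),
    hsplit _ 1 2 2 (hi _ (hd _ q0)), hsplit _ 2 1 2 (hi _ (hi _ (hd _ q0))),
    hsplit _ 2 1 2 (hd _ (hd _ q0)), hsplit _ 1 2 2 (hi _ (hd _ (hd _ q0)))]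
  have key : ∀ {S : Set (ℝ × ℝ)} (a b c d e f : ℝ) (g : SignedPerm) (x y : ℤ),
      |a * d - b * c| = 1 →
      (∀ u, (g • ofCoord u).1 0 + x = a * u.1 + b * u.2 + e ∧
        (g • ofCoord u).1 1 + y = c * u.1 + d * u.2 + f) →
      (∀ u : ℝ × ℝ, 0 < u.2 → u.2 < u.1 → 2 * u.1 + u.2 < 1 → affineMap a b c d e f u ∈ S) →
      (∀ u, affineMap a b c d e f u ∈ S → u ∈ coordTriangle) →
      ∫ u in S, G u = ∫ u in coordTriangle, G u := fun a b c d e f g x y hdet h h1 h2 =>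
    setIntegral_eq_coordTriangle a b c d e f hdet (comp_affineMap hF a b c d e f g x y h) h1 h2
  have htwelve : 12 * ∫ u in coordTriangle, G u = ((∫ u in coordTriangle, G u) +
      ((∫ u in coordTriangle, G u) + ∫ u in coordTriangle, G u) +
      ((∫ u in coordTriangle, G u) +
        ((∫ u in coordTriangle, G u) + ∫ u in coordTriangle, G u))) +
      ((∫ u in coordTriangle, G u) + (∫ u in coordTriangle, G u) +
        (∫ u in coordTriangle, G u) +
      ((∫ u in coordTriangle, G u) + (∫ u in coordTriangle, G u) +
        ∫ u in coordTriangle, G u)) := by ring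
  rw [htwelve]
  refine congrArg₂ _ (congrArg₂ _ (congrArg₂ _ ?_ (congrArg₂ _ ?_ ?_))
    (congrArg₂ _ ?_ (congrArg₂ _ ?_ ?_))) (congrArg₂ _ (congrArg₂ _ (congrArg₂ _ ?_ ?_) ?_)
    (congrArg₂ _ (congrArg₂ _ ?_ ?_) ?_))
  -- Each signed permutation occurs once, with the integer translation that brings the image of
  -- `coordTriangle` into the square.
  refine key 1 0 0 1 0 0 (1, 1) 0 0 ?_ ?_ ?_ ?_
  rotate_left 4
  refine key (-1) (-1) 0 1 1 0 (swap 0 2, 1) 1 0 ?_ ?_ ?_ ?_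
  rotate_left 4
  refine key (-1) (-1) 1 0 1 0 (swap 0 1 * swap 1 2, 1) 1 0 ?_ ?_ ?_ ?_
  rotate_left 4
  refine key 0 1 1 0 0 0 (swap 0 1, 1) 0 0 ?_ ?_ ?_ ?_
  rotate_left 4
  refine key 0 1 (-1) (-1) 0 1 (swap 1 2 * swap 0 1, 1) 0 1 ?_ ?_ ?_ ?_
  rotate_left 4
  refine key 1 0 (-1) (-1) 0 1 (swap 1 2, 1) 0 1 ?_ ?_ ?_ ?_
  rotate_left 4
  refine key (-1) 0 1 1 1 0 (swap 1 2, -1) 1 0 ?_ ?_ ?_ ?_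
  rotate_left 4
  refine key 0 (-1) 1 1 1 0 (swap 1 2 * swap 0 1, -1) 1 0 ?_ ?_ ?_ ?_
  rotate_left 4
  refine key 0 (-1) (-1) 0 1 1 (swap 0 1, -1) 1 1 ?_ ?_ ?_ ?_
  rotate_left 4
  refine key 1 1 (-1) 0 0 1 (swap 0 1 * swap 1 2, -1) 0 1 ?_ ?_ ?_ ?_
  rotate_left 4
  refine key 1 1 0 (-1) 0 1 (swap 0 2, -1) 0 1 ?_ ?_ ?_ ?_
  rotate_left 4
  refine key (-1) 0 0 (-1) 1 1 (1, -1) 1 1 ?_ ?_ ?_ ?_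
  rotate_left 4
  any_goals norm_num; done
  all_goals intro u
  any_goals
    simp only [smul_mk_neg_one_eq, smul_one_one, smul_swap01, smul_swap02, smul_swap12, smul_rot,
      smul_rot_inv, neg_pt, pt_zero, pt_one, pt_two, ofCoord]
    push_cast
    constructor <;> ring
  any_goals
    intro h1 h2 h3
    simp only [hQ, affineMap, mem_inter_iff, mem_sdiff, mem_prod, mem_Ioc, mem_ofPred_eq, not_le]
    constructorm* _ ∧ _ <;> linarith
  all_goals
    intro h
    simp only [hQ, affineMap, mem_inter_iff, mem_sdiff, mem_prod, mem_Ioc, mem_ofPred_eq,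
      not_le] at h
    casesm* _ ∧ _
    simp only [coordTriangle, mem_ofPred_eq]
    refine ⟨?_, ?_, ?_⟩ <;> linarith

theorem continuous_expChar : Continuous expChar := by
  have h : (expChar : ℝ → ℂ) = fun x : ℝ => Complex.exp (2 * Real.pi * Complex.I * x) := rfl
  rw [h]
  fun_prop

theorem expChar_intCast (m : ℤ) : expChar m = 1 := by
  rw [expChar_apply, Complex.exp_eq_one_iff]
  exact ⟨m, by push_cast; ring⟩

theorem integral_expChar (m : ℤ) :
    ∫ x in Ioc (0 : ℝ) 1, expChar (m * x) = if m = 0 then 1 else 0 := by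
  rw [← intervalIntegral.integral_of_le zero_le_one]
  split_ifs with h
  · simp [h]
  · have hc : 2 * Real.pi * Complex.I * (m : ℂ) ≠ 0 :=
      mul_ne_zero Complex.two_pi_I_ne_zero (by exact_mod_cast h)
    have h1 := expChar_intCast m
    rw [expChar_apply] at h1
    have h2 : ∀ x : ℝ, expChar (m * x) = Complex.exp (2 * Real.pi * Complex.I * m * x) := by
      intro x
      rw [expChar_apply]
      congr 1
      push_cast
      ring
    simp only [h2]
    rw [integral_exp_mul_complex hc]
    push_cast at h1
    simp [h1]

theorem symp_ofCoord (k : Homog ℤ) (u : ℝ × ℝ) :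
    symp (castH ℝ k) (ofCoord u) = (k.1 1 : ℤ) * u.1 + ((-k.1 0 : ℤ) : ℝ) * u.2 := by
  simp only [symp, castH_coord, ofCoord, pt_zero, pt_one]
  push_cast
  ring

theorem integral_expChar_symp (k : Homog ℤ) :
    ∫ u in Ioc (0 : ℝ) 1 ×ˢ Ioc (0 : ℝ) 1, expChar (symp (castH ℝ k) (ofCoord u)) =
      if k = 0 then 1 else 0 := by
  simp only [symp_ofCoord, AddChar.map_add_eq_mul]
  rw [Measure.volume_eq_prod, setIntegral_prod_mul (fun x : ℝ => expChar ((k.1 1 : ℤ) * x))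
    (fun x : ℝ => expChar (((-k.1 0 : ℤ) : ℝ) * x)), integral_expChar, integral_expChar]
  simp only [neg_eq_zero, homog_ext_iff]
  show _ = if k.1 0 = 0 ∧ k.1 1 = 0 then _ else _
  by_cases h0 : k.1 0 = 0 <;> by_cases h1 : k.1 1 = 0 <;> simp [h0, h1]

theorem continuous_expChar_symp (k : Homog ℤ) :
    Continuous fun u => expChar (symp (castH ℝ k) (ofCoord u)) := by
  simp only [symp_ofCoord]
  exact continuous_expChar.comp (by fun_prop)

theorem continuous_trigSum (k : Homog ℤ) :
    Continuous fun u => trigSum expChar 1 (castH ℝ k) (ofCoord u) := by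
  simp only [trigSum, ← castH_smul]
  refine continuous_const.mul (continuous_finsetSum _ fun g _ => ?_)
  exact continuous_const.mul (continuous_expChar_symp _)

theorem smul_eq_zero_iff_homog (g : SignedPerm) (k : Homog ℤ) : g • k = 0 ↔ k = 0 := by
  have h : g • (0 : Homog ℤ) = 0 := by
    ext i
    simp [smul_coord]
  rw [smul_eq_iff_eq_inv_smul, ← h, inv_smul_smul, h]

theorem integral_trigSum (k : Homog ℤ) :
    ∫ u in Ioc (0 : ℝ) 1 ×ˢ Ioc (0 : ℝ) 1, trigSum expChar 1 (castH ℝ k) (ofCoord u) =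
      if k = 0 then 1 else 0 := by
  simp only [trigSum, ← castH_smul, MonoidHom.one_apply, Units.val_one, Int.cast_one, one_mul]
  rw [integral_const_mul, integral_finsetSum]
  · simp only [integral_expChar_symp, smul_eq_zero_iff_homog]
    rw [Finset.sum_const, Finset.card_univ, card_signedPerm]
    split_ifs <;> norm_num
  · intro g _
    exact ((continuous_expChar_symp _).continuousOn.integrableOn_compact
      (isCompact_Icc.prod isCompact_Icc : IsCompact (Icc (0 : ℝ) 1 ×ˢ Icc (0 : ℝ) 1))).mono_set
      (prod_mono Ioc_subset_Icc_self Ioc_subset_Icc_self)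

theorem trigSum_smul_add (k : Homog ℤ) (g : SignedPerm) (l : Homog ℤ) (v : Homog ℝ) :
    trigSum expChar 1 (castH ℝ k) (g • v + castH ℝ l) = trigSum expChar 1 (castH ℝ k) v := by
  have h1 : trigSum expChar 1 (castH ℝ k) (g • v) = trigSum expChar 1 (castH ℝ k) v := by
    rw [trigSum_smul]
    simp
  rw [← h1, trigSum, trigSum]
  congr 1
  refine Finset.sum_congr rfl fun h _ => ?_
  have h2 : symp (h • castH ℝ k) (g • v + castH ℝ l) =
      symp (h • castH ℝ k) (g • v) + (symp (h • k) l : ℤ) := by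
    rw [← symp_castH, castH_smul]
    simp only [symp, Submodule.coe_add, Pi.add_apply]
    ring
  rw [h2, AddChar.map_add_eq_mul, expChar_intCast, mul_one]

theorem continuous_ofCoord : Continuous ofCoord := by
  refine Continuous.subtype_mk (continuous_pi fun i => ?_) _
  fin_cases i
  · exact continuous_fst
  · exact continuous_snd
  · exact (continuous_fst.neg.sub continuous_snd)

theorem ofCoord_injective : Function.Injective ofCoord := by
  intro u v h
  exact Prod.ext (congrArg (fun t : Homog ℝ => t.1 0) h) (congrArg (fun t : Homog ℝ => t.1 1) h)

theorem measurableEmbedding_ofCoord : MeasurableEmbedding ofCoord :=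
  continuous_ofCoord.measurableEmbedding ofCoord_injective

theorem ofCoord_affineMap (u : ℝ × ℝ) : ofCoord (affineMap 1 2 1 (-1) 0 0 u) =
    hat (((swap 1 2, 1) : SignedPerm) • ofCoord u) := by
  rw [smul_swap12]
  apply homog_ext <;>
  simp only [ofCoord, affineMap, hat, pt_zero, pt_one, pt_two] <;> ring

/-- The factor 3 is the absolute determinant of `hat` composed with the reflection, in the first two
coordinates. -/
theorem setIntegral_triangle (f : Homog ℝ → ℂ) :
    ∫ t in triangle, f t ∂area =
      3 * ∫ u in coordTriangle, f (hat (((swap 1 2, 1) : SignedPerm) • ofCoord u)) := by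
  have h : (affineMap 1 2 1 (-1) 0 0 ⁻¹' (ofCoord ⁻¹' triangle)) = coordTriangle := by
    ext u
    simp only [mem_preimage, triangle, coordTriangle, mem_ofPred_eq, ofCoord, affineMap, pt_zero,
      pt_one, pt_two]
    constructor
    · rintro ⟨h1, h2, h3, h4⟩
      refine ⟨?_, ?_, ?_⟩ <;> linarith
    · rintro ⟨h1, h2, h3⟩
      refine ⟨?_, ?_, ?_, ?_⟩ <;> linarith
  rw [area, show (fun p : ℝ × ℝ => pt p.1 p.2 (-p.1 - p.2) (by ring)) = ofCoord from rfl,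
    measurableEmbedding_ofCoord.setIntegral_map,
    setIntegral_comp_affineMap (a := 1) (b := 2) (c := 1) (d := -1) 0 0 (by norm_num), h]
  simp only [ofCoord_affineMap]
  norm_num

theorem triangleMean_eq {f F : Homog ℝ → ℂ} (hc : Continuous fun u => F (ofCoord u))
    (hF : ∀ (g : SignedPerm) (l : Homog ℤ) v, F (g • v + castH ℝ l) = F v)
    (hf : ∀ v, f (hat v) = F v) :
    triangleMean f = ∫ u in Ioc (0 : ℝ) 1 ×ˢ Ioc (0 : ℝ) 1, F (ofCoord u) := by
  have h0 : castH ℝ 0 = 0 := by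
    ext i
    simp [castH_coord]
  have hF' : ∀ (g : SignedPerm) v, F (g • v) = F v := by
    intro g v
    rw [← hF g 0 v, h0, add_zero]
  -- The area comes from the same two integral formulas applied to the constant 1: `1 = 12 · vol`
  -- and `area = 3 · vol`, where `vol` is the volume of `coordTriangle`.
  have h1 : (area.real triangle : ℂ) = 1 / 4 := by
    have h2 := setIntegral_triangle fun _ => 1
    have h3 := setIntegral_unitSquare (F := fun _ => 1) continuous_const fun _ _ _ => rfl
    rw [setIntegral_const] at h2 h3
    have h4 : (volume : Measure (ℝ × ℝ)).real (Ioc (0 : ℝ) 1 ×ˢ Ioc (0 : ℝ) 1) = 1 := by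
      rw [Measure.volume_eq_prod, measureReal_prod_prod]
      simp
    rw [h4, one_smul] at h3
    rw [Complex.real_smul, mul_one] at h2
    rw [h2]
    linear_combination -(1 / 4 : ℂ) * h3
  rw [triangleMean, h1, setIntegral_triangle]
  simp only [hf, hF']
  rw [setIntegral_unitSquare hc hF]
  ring

/-! ### Exactness of the cubature rule -/

theorem triangleMean_CC (k : Homog ℤ) : triangleMean (CC k) = if k = 0 then 1 else 0 := by
  rw [triangleMean_eq (continuous_trigSum k) (trigSum_smul_add k) (CC_hat k), integral_trigSum]

theorem coordTriangle_subset_unitSquare : coordTriangle ⊆ Icc (0 : ℝ) 1 ×ˢ Icc (0 : ℝ) 1 := by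
  rintro u ⟨h1, h2, h3⟩
  refine ⟨⟨?_, ?_⟩, ?_, ?_⟩ <;> linarith

theorem triangleMean_eq_coord (f : Homog ℝ → ℂ) : triangleMean f =
    3 / (area.real triangle : ℂ) *
      ∫ u in coordTriangle, f (hat (((swap 1 2, 1) : SignedPerm) • ofCoord u)) := by
  rw [triangleMean, setIntegral_triangle]
  ring

theorem triangleMean_eq_cubature {n : ℕ} (hn : 0 < n) {f : Homog ℝ → ℂ}
    (hf : f ∈ Hcc (2 * (n : ℤ) - 1)) : triangleMean f = cubature n f := by
  have : NeZero n := ⟨hn.ne'⟩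
  -- Continuity in coordinates is carried through the induction on the span because additivity of
  -- the integral needs integrability.
  suffices h : Continuous (fun u => f (hat (((swap 1 2, 1) : SignedPerm) • ofCoord u))) ∧
      triangleMean f = cubature n f from h.2
  have hint : ∀ f : ℝ × ℝ → ℂ, Continuous f → IntegrableOn f coordTriangle := fun f hf =>
    (hf.continuousOn.integrableOn_compact
      (isCompact_Icc.prod isCompact_Icc : IsCompact (Icc (0 : ℝ) 1 ×ˢ Icc (0 : ℝ) 1))).mono_set
      coordTriangle_subset_unitSquare
  refine Submodule.span_induction (p := fun f _ =>
    Continuous (fun u => f (hat (((swap 1 2, 1) : SignedPerm) • ofCoord u))) ∧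
      triangleMean f = cubature n f) ?_ ?_ ?_ ?_ hf
  · rintro _ ⟨k, ⟨h1, h2, h3⟩, rfl⟩
    refine ⟨?_, ?_⟩
    · refine (continuous_trigSum k).congr fun u => ?_
      rw [CC_hat, trigSum_smul]
      simp
    · rw [triangleMean_CC, cubature_CC]
      refine if_congr ⟨?_, fun h => ?_⟩ rfl rfl
      · rintro rfl
        ext i
        simp [castH_coord]
      · have h0 : castH (ZMod n) 0 = 0 := by
          ext i
          simp [castH_coord]
        rw [← h0, castH_zmod_eq_iff] at h
        have sk := sum_zero k
        -- Membership in `Γcc (2n - 1)` gives `2k₁ + k₂ ≤ 2n - 1`, hence `0 ≤ k₁ < n`. So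
        -- divisibility by `n` forces `k₁ = 0`, and `0 ≤ k₂ ≤ k₁` does the rest.
        have e0 := Int.eq_zero_of_abs_lt_dvd h.1 (by
          rw [abs_lt]; simp only [Submodule.coe_zero, Pi.zero_apply]; omega)
        simp only [Submodule.coe_zero, Pi.zero_apply] at e0
        refine homog_ext ?_ ?_ <;> simp only [Submodule.coe_zero, Pi.zero_apply] <;> omega
  · refine ⟨continuous_const, ?_⟩
    simp [triangleMean, cubature]
  · rintro f g - - ⟨hf1, hf2⟩ ⟨hg1, hg2⟩
    refine ⟨hf1.add hg1, ?_⟩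
    have h : cubature n (f + g) = cubature n f + cubature n g := by
      simp only [cubature, Pi.add_apply, mul_add, Finset.sum_add_distrib]
    rw [h, ← hf2, ← hg2, triangleMean_eq_coord, triangleMean_eq_coord, triangleMean_eq_coord]
    simp only [Pi.add_apply]
    rw [integral_add (hint _ hf1) (hint _ hg1), mul_add]
  · rintro c f - ⟨hf1, hf2⟩
    refine ⟨hf1.const_smul c, ?_⟩
    have h : cubature n (c • f) = c * cubature n f := by
      simp only [cubature, Pi.smul_apply, smul_eq_mul, mul_left_comm _ c, ← Finset.mul_sum]
    rw [h, ← hf2, triangleMean_eq_coord, triangleMean_eq_coord]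
    simp only [Pi.smul_apply, smul_eq_mul]
    rw [integral_const_mul, mul_left_comm]

end G2Triangle

end

theorem mainTheorem1 (n : ℕ) (hn : 0 < n) :
    -- the cubature rule is exact on the space spanned by the `CC_k`, `k ∈ Γ_{2n-1}`
    (∀ f ∈ Hcc (2 * (n : ℤ) - 1), triangleMean f = cubature n f) ∧
    -- the values of the weights
    ((∀ j ∈ Υint n, ω n j = 12) ∧
      ω n 0 = 1 ∧
      (∀ j ∈ Υ n, j.1 0 = n → j.1 1 = 0 → j.1 2 = -n → ω n j = 2) ∧
      (∀ j ∈ Υ n, 2 * j.1 0 = n → 2 * j.1 1 = n → j.1 2 = -n → ω n j = 3) ∧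
      (∀ j ∈ Υ n, j ∉ Υint n → j ≠ 0 → ¬ (j.1 0 = n ∧ j.1 1 = 0 ∧ j.1 2 = -n) →
        ¬ (2 * j.1 0 = n ∧ 2 * j.1 1 = n ∧ j.1 2 = -n) → ω n j = 6)) ∧
    -- discrete orthogonality of the four families
    (∀ j ∈ Γcc n, ∀ k ∈ Γcc n,
      discreteInner n (CC j) (CC k) =
          (if j = k then 1 else 0) / (hexWeight n (hat k) * (orbit k).ncard : ℝ) ∧
        discreteInner n (CC j) (CC k) = (if j = k then 1 else 0) / (ω n (hat k) : ℂ)) ∧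
    (∀ j ∈ Γsc n, ∀ k ∈ Γsc n,
      discreteInner n (SC j) (SC k) =
          (if j = k then 1 else 0) / (hexWeight n (hat k) * (orbit k).ncard : ℝ) ∧
        discreteInner n (SC j) (SC k) = (if j = k then 1 else 0) / (ω n (hat k) : ℂ)) ∧
    (∀ j ∈ Γcs n, ∀ k ∈ Γcs n,
      discreteInner n (CS j) (CS k) =
          (if j = k then 1 else 0) / (hexWeight n (hat k) * (orbit k).ncard : ℝ) ∧
        discreteInner n (CS j) (CS k) = (if j = k then 1 else 0) / (ω n (hat k) : ℂ)) ∧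
    (∀ j ∈ Γss n, ∀ k ∈ Γss n,
      discreteInner n (SS j) (SS k) =
          (if j = k then 1 else 0) / (hexWeight n (hat k) * (orbit k).ncard : ℝ) ∧
        discreteInner n (SS j) (SS k) = (if j = k then 1 else 0) / (ω n (hat k) : ℂ) ∧
        discreteInner n (SS j) (SS k) = (if j = k then 1 else 0) / 12) := by
  have : NeZero n := ⟨hn.ne'⟩
  refine ⟨fun f hf => triangleMean_eq_cubature hn hf,
    ⟨fun j hj => ω_interior hn hj, ω_zero hn, fun j hj h0 h1 _ => ω_vertex hn hj h0 h1,
      fun j hj h0 h1 _ => ω_midpoint hn hj h0 h1,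
      fun j hj hint h0 h1 h2 => ω_side hn hj hint h0 h1 h2⟩, ?_, ?_, ?_, ?_⟩
  · intro j hj k hk
    exact discreteInner_eq 1 1 (by simp) CC (fun k v => by rw [CC_hat, one_mul]) hj hk
      fun _ _ => rfl
  · intro j hj k hk
    refine discreteInner_eq _ _ I_inv_mul_conj SC SC_hat (Γsc_subset _ hj) (Γsc_subset _ hk)
      fun g hg => ?_
    rcases stabilizer_Γsc hn hk g hg with rfl | rfl
    · exact map_one _
    · decide
  · intro j hj k hk
    exact discreteInner_eq _ _ I_inv_mul_conj CS CS_hat (Γcs_subset _ hj) (Γcs_subset _ hk)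
      fun g hg => stabilizer_Γcs hn hk g hg
  · intro j hj k hk
    obtain ⟨h1, h2⟩ := discreteInner_eq permSign (-1) (by simp) SS
      (fun k v => by rw [SS_hat, neg_one_mul]) (Γss_subset _ hj) (Γss_subset _ hk)
      fun g hg => by rw [stabilizer_Γss hn hk g hg, map_one]
    exact ⟨h1, h2, by rw [h2, ω_hat_Γss hn hk]; norm_num⟩
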